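/- **Setting.** $\mathsf{Catt}_{\mathsf{sua}}$ is the type theory $\mathsf{Catt}$ (contexts; types $\star$ and $s \to_A t$; terms that are variables or coherences $\mathrm{Coh}(\Delta : A)[\sigma]$; pasting contexts are the contexts $\lfloor T\rfloor$ of finite planar rooted trees $T=[T_1,\dots,T_m]$, where $\lfloor T\rfloor=\Sigma\lfloor T_1\rfloor\vee\dots\vee\Sigma\lfloor T_m\rfloor$), with the conversion rule and with definitional equality generated by disc removal, endo-coherence removal and insertion. A tree is also written for its context, $\equiv$ is syntactic equality, and $D^n$ is the disc context, i.e. the context of the linear tree of dimension $n$, with top variable $d_n$. *Unbiased expressions.* For a tree $T$ with $n$-dimensional boundary $\partial_n T$ and boundary inclusions $\delta_n^{\pm}:\partial_nT\to T$, put $\mathcal U_T^0=\star$, $\mathcal U_T^{n+1}=\mathcal T_{\partial_nT}^n[\delta_n^-]\to_{\mathcal U_T^n}\mathcal T_{\partial_nT}^n[\delta_n^+]$, $\mathcal C_T^n=\mathrm{Coh}(T:\mathcal U_T^n)[\mathrm{id}]$, and $\mathcal T_T^n=d_n$ if $T=D^n$, $\mathcal T_T^n=\mathcal C_T^n$ otherwise.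 *Insertion.* A branch $P$ of a tree $S$ is a non-empty list of indices that leads to a linear subtree of $S$; its branch height $\mathrm{bh}(P)$ is its length minus one, and its leaf height $\mathrm{lh}(P)$ is the dimension of the corresponding locally maximal variable, also written $P$, of $S$. The trunk height is $\mathrm{th}([T_1])=1+\mathrm{th}(T_1)$, and $\mathrm{th}(T)=0$ if $T$ does not have exactly one branch at its root. If $\mathrm{bh}(P)\le\mathrm{th}(T)$, the inserted tree is $S\ll_{[k]}T=[S_1,\dots,S_{k-1}]\mathbin{+\!\!+}T\mathbin{+\!\!+}[S_{k+1},\dots,S_m]$ and $S\ll_{k::P'}[T_1]=[S_1,\dots,S_{k-1},\,S_k\ll_{P'}T_1,\,S_{k+1},\dots,S_m]$. The exterior substitution $\kappa:S\to S\ll_PT$ is defined along the same recursion: for $P=[k]$ it is $\{\mathcal U_T^{\mathrm{lh}(P)},\mathcal C_T^{\mathrm{lh}(P)}\}$ on the disc $\Sigma S_k$ and the identity on the other wedge summands; for $P=k::P'$ it is the suspension of the exterior substitution of $(S_k,P',T_1)$ on $\Sigma S_k$ and the identity on the other summands. For substitutions $\sigma:S\to\Gamma$ and $\tau:T\to\Gamma$,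 regarded as labellings of trees, $\sigma\ll_P\tau:S\ll_PT\to\Gamma$ is the labelling that takes the labels of $\tau$ on the inserted copy of $T$ (including its end points and, for longer $P$, the end points of the summands along $P$) and the labels of $\sigma$ elsewhere. An insertion redex $(S,P,T,\Gamma,\sigma,\tau)$ consists of trees $S,T$, a branch $P$ of $S$ with $\mathrm{bh}(P)\le\mathrm{th}(T)$, a context $\Gamma$, and substitutions $\sigma:S\to\Gamma$, $\tau:T\to\Gamma$, valid in $\mathsf{Catt}_{\mathsf{sua}}$ (that is, $\Gamma\vdash\sigma:S$ and $\Gamma\vdash\tau:T$), such that $P[\sigma]\equiv\mathcal C_T^{\mathrm{lh}(P)}[\tau]$. The insertion rule of $\mathsf{Catt}_{\mathsf{sua}}$ equates $\mathrm{Coh}(S:A)[\sigma]$ and $\mathrm{Coh}(S\ll_PT:A[\kappa])[\sigma\ll_P\tau]$ when $\mathrm{Coh}(S:A)[\sigma]$ is not an identity and $\mathcal C_T^{\mathrm{lh}(P)}$ is an unbiased composite ($\mathrm{lh}(P)=\dim T$) or an identity. **Theorem.** Let $(S,P,T,\Gamma,\sigma,\tau)$ be an insertion redex and let $n\ge\dim(T)$.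 Then in $\mathsf{Catt}_{\mathsf{sua}}$ $$\Gamma\vdash \mathrm{Coh}\bigl(S\ll_PT:\mathcal U_S^n[\kappa]\bigr)\bigl[\sigma\ll_P\tau\bigr]\;=\;\mathcal C_{S\ll_PT}^n\bigl[\sigma\ll_P\tau\bigr].$$ -/

import Mathlib

namespace CattSua

/-! ### Raw expressions

Variables are de Bruijn levels: in a context of length `n` they are the elements of `Fin n`, and
the variable added last is `Fin.last`. Every expression is well scoped by construction. -/

mutual

/-- Contexts of length `n`. -/
inductive Ctx : ℕ → Type
  | nil : Ctx 0
  | snoc {n : ℕ} (Γ : Ctx n) (A : Ty n) : Ctx (n + 1)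

/-- Types over a context of length `n`. -/
inductive Ty : ℕ → Type
  | star {n : ℕ} : Ty n
  | arr {n : ℕ} (s : Tm n) (A : Ty n) (t : Tm n) : Ty n

/-- Terms over a context of length `n`; `coh Δ A σ` is the term `Coh (Δ : A)[σ]`. -/
inductive Tm : ℕ → Type
  | var {n : ℕ} (x : Fin n) : Tm n
  | coh {k n : ℕ} (Δ : Ctx k) (A : Ty k) (σ : Fin k → Tm n) : Tm n

end

/-- Substitutions from a context of length `m` to a context of length `n`:
one term over the codomain for each variable of the domain. -/
abbrev Sub (m n : ℕ) : Type := Fin m → Tm n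

/-- The action `t⟦σ⟧` of a substitution on a term. -/
def Tm.sub {m n : ℕ} : Tm m → Sub m n → Tm n
  | .var x, σ => σ x
  | .coh Δ A τ, σ => .coh Δ A (fun i => (τ i).sub σ)

/-- The action `A⟦σ⟧` of a substitution on a type. -/
def Ty.sub {m n : ℕ} : Ty m → Sub m n → Ty n
  | .star, _ => .star
  | .arr s A t, σ => .arr (s.sub σ) (A.sub σ) (t.sub σ)

/-- Composition of substitutions in diagrammatic order. -/
def Sub.comp {l m n : ℕ} (σ : Sub l m) (τ : Sub m n) : Sub l n := fun i => (σ i).sub τ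

/-- The substitution that renames variables along `f`. -/
def Sub.ren {m n : ℕ} (f : Fin m → Fin n) : Sub m n := fun i => .var (f i)

/-- The identity substitution. -/
def Sub.ident (n : ℕ) : Sub n n := fun i => .var i

/-- The dimension of a type. -/
def Ty.dim {n : ℕ} : Ty n → ℕ
  | .star => 0
  | .arr _ A _ => A.dim + 1

/-- The type of a variable of a context, weakened to the whole context. -/
def Ctx.lookup {n : ℕ} : Ctx n → Fin n → Ty n
  | .nil, x => x.elim0
  | .snoc Γ A, x =>
      Fin.lastCases (motive := fun _ => Ty _) (A.sub (Sub.ren Fin.castSucc))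
        (fun y => (Γ.lookup y).sub (Sub.ren Fin.castSucc)) x

/-! ### Free variables and support -/

/-- The free variables of a term. -/
def Tm.fv {n : ℕ} : Tm n → Set (Fin n)
  | .var x => {x}
  | .coh _ _ σ => ⋃ i, (σ i).fv

/-- The free variables of a type. -/
def Ty.fv {n : ℕ} : Ty n → Set (Fin n)
  | .star => ∅
  | .arr s A t => s.fv ∪ A.fv ∪ t.fv

/-- Downward closed sets of variables of a context. -/
def Ctx.DownClosed {n : ℕ} (Γ : Ctx n) (X : Set (Fin n)) : Prop :=
  ∀ x ∈ X, (Γ.lookup x).fv ⊆ X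

/-- The downward closure of a set of variables. -/
def Ctx.downClosure {n : ℕ} (Γ : Ctx n) (X : Set (Fin n)) : Set (Fin n) :=
  ⋂₀ {Y | X ⊆ Y ∧ Γ.DownClosed Y}

/-- The support of a term over `Γ`. -/
def Tm.supp {n : ℕ} (Γ : Ctx n) (t : Tm n) : Set (Fin n) := Γ.downClosure t.fv

/-- The support of a substitution with codomain `Γ`. -/
def Sub.supp {m n : ℕ} (Γ : Ctx n) (σ : Sub m n) : Set (Fin n) := Γ.downClosure (⋃ i, (σ i).fv)

/-! ### Suspension

The new variables `N` and `S` are the levels `0` and `1`; the level `i` becomes `i + 2`. -/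

mutual

/-- Suspension of contexts. -/
def Ctx.susp {n : ℕ} : Ctx n → Ctx (n + 2)
  | .nil => .snoc (.snoc .nil .star) .star
  | .snoc Γ A => .snoc Γ.susp A.susp

/-- Suspension of types. -/
def Ty.susp {n : ℕ} : Ty n → Ty (n + 2)
  | .star => .arr (.var 0) .star (.var 1)
  | .arr s A t => .arr s.susp A.susp t.susp

/-- Suspension of terms. -/
def Tm.susp {n : ℕ} : Tm n → Tm (n + 2)
  | .var x => .var x.succ.succ
  | .coh Δ A σ => .coh Δ.susp A.susp
      (Fin.cases (motive := fun _ => Tm _) (.var 0)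
        (Fin.cases (motive := fun _ => Tm _) (.var 1) (fun i => (σ i).susp)))

end

/-- Suspension of substitutions. -/
def Sub.susp {m n : ℕ} (σ : Sub m n) : Sub (m + 2) (n + 2) :=
  Fin.cases (motive := fun _ => Tm _) (.var 0)
    (Fin.cases (motive := fun _ => Tm _) (.var 1) (fun i => (σ i).susp))

/-! ### Wedge sums

The wedge sum of a context of length `n + 1`, pointed at its variable `p`, with a context of
length `m + 1`, pointed at its first variable. -/

/-- The variables of the left summand of a wedge sum. -/
def wl {n m : ℕ} (i : Fin (n + 1)) : Fin (n + m + 1) := ⟨i, by omega⟩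

/-- The variables of the right summand of a wedge sum; its first variable is glued to `p`. -/
def wr {n m : ℕ} (p : Fin (n + 1)) : Fin (m + 1) → Fin (n + m + 1) :=
  Fin.cases (wl p) (fun j => ⟨n + 1 + j, by omega⟩)

/-- The wedge sum `Γ ∨ Δ`, in which the first variable of `Δ` is replaced by the variable `p`
of `Γ`. -/
def Ctx.wedge {n : ℕ} (Γ : Ctx (n + 1)) (p : Fin (n + 1)) :
    {m : ℕ} → Ctx (m + 1) → Ctx (n + m + 1)
  | 0, _ => Γ
  | _ + 1, .snoc Δ A => .snoc (Γ.wedge p Δ) (A.sub (Sub.ren (wr p)))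

/-- The family on the variables of a wedge sum that is `f` on the left summand and `g` on the
right one (the value at the common variable is the one given by `f`). -/
def wedgeElim {X : Type} {n m : ℕ} (f : Fin (n + 1) → X) (g : Fin (m + 1) → X) :
    Fin (n + m + 1) → X :=
  fun i => if h : (i : ℕ) < n + 1 then f ⟨i, h⟩ else g ⟨i - n, by omega⟩

/-- The wedge sum `σ ∨ τ` of two substitutions, with `p` the gluing point in the codomain. -/
def Sub.wedge {n m n' m' : ℕ} (σ : Sub (n + 1) (n' + 1)) (p : Fin (n' + 1))
    (τ : Sub (m + 1) (m' + 1)) : Sub (n + m + 1) (n' + m' + 1) :=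
  wedgeElim (σ.comp (Sub.ren wl)) (τ.comp (Sub.ren (wr p)))

/-! ### Trees and pasting contexts -/

/-- Planar rooted trees. A tree is a list of trees: `nil` is the empty list and `cons T Ts` is the
list with first element `T` and tail `Ts` (itself a list of trees, hence a tree). -/
inductive Tree : Type
  | nil : Tree
  | cons (T : Tree) (Ts : Tree) : Tree
  deriving DecidableEq

namespace Tree

/-- One less than the number of variables of the context of a tree. -/
def len : Tree → ℕ
  | nil => 0
  | cons T Ts => T.len + 2 + Ts.len

/-- The pasting context `⌊[T₁, …, Tₙ]⌋ = Σ⌊T₁⌋ ∨ ⋯ ∨ Σ⌊Tₙ⌋` of a tree, a single variable of type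
`⋆` for the empty tree. The gluing point of each `Σ⌊Tᵢ⌋` is its variable `S`. -/
def ctx : (T : Tree) → Ctx (T.len + 1)
  | nil => .snoc .nil .star
  | cons T Ts => T.ctx.susp.wedge 1 Ts.ctx

/-- The dimension of a tree. -/
def dim : Tree → ℕ
  | nil => 0
  | cons T Ts => max (T.dim + 1) Ts.dim

/-- The trunk height of a tree. -/
def th : Tree → ℕ
  | nil => 0
  | cons T nil => T.th + 1
  | cons _ (cons _ _) => 0

/-- The linear tree of dimension `n`. Its context is the disc context `Dⁿ`, with the variables in
the order `d₀⁻, d₀⁺, …, dₙ₋₁⁻, dₙ₋₁⁺, dₙ`. -/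
def disc : ℕ → Tree
  | 0 => nil
  | n + 1 => cons (disc n) nil

/-- Concatenation of lists of trees. -/
def append : Tree → Tree → Tree
  | nil, Us => Us
  | cons T Ts, Us => cons T (Ts.append Us)

/-- The last variable of type `⋆` in the context of a tree. -/
def lastPt : (T : Tree) → Fin (T.len + 1)
  | nil => 0
  | cons _ Ts => wr 1 Ts.lastPt

/-- The inclusion of the variables of `⌊T⌋` into those of `⌊T ++ U⌋ = ⌊T⌋ ∨ ⌊U⌋`. -/
def appendInl : (T U : Tree) → Fin (T.len + 1) → Fin ((T.append U).len + 1)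
  | nil, _ => fun _ => 0
  | cons _ Ts, U => wedgeElim wl (fun i => wr 1 (Ts.appendInl U i))

/-- The inclusion of the variables of `⌊U⌋` into those of `⌊T ++ U⌋ = ⌊T⌋ ∨ ⌊U⌋`. -/
def appendInr : (T U : Tree) → Fin (U.len + 1) → Fin ((T.append U).len + 1)
  | nil, _ => fun i => i
  | cons _ Ts, U => fun i => wr 1 (Ts.appendInr U i)

/-- The `n`-dimensional boundary `∂ₙ T`: the tree is cut off at height `n`. -/
def bdry : Tree → ℕ → Tree
  | nil, _ => nil
  | cons _ _, 0 => nil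
  | cons T Ts, n + 1 => cons (T.bdry n) (Ts.bdry (n + 1))

/-- The inclusion `∂ₙ T → T` of the source boundary (`ε = false`) or of the target boundary
(`ε = true`). -/
def incl (ε : Bool) : (T : Tree) → (n : ℕ) → Sub ((T.bdry n).len + 1) (T.len + 1)
  | nil, _ => Sub.ident _
  | cons T Ts, 0 => fun _ => .var (if ε then (cons T Ts).lastPt else 0)
  | cons T Ts, n + 1 => (T.incl ε n).susp.wedge 1 (Ts.incl ε (n + 1))

end Tree

/-! ### Unbiased types, terms and coherences -/

/-- The unbiased type `𝒰` of dimension `n` over a tree. The terms in it are the unbiased terms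
over the boundaries `∂ₘ T`, `m < n`, that is, `dₘ` if `∂ₘ T` is the disc of dimension `m`, and the
unbiased coherence otherwise. -/
def unbTy : (n : ℕ) → (T : Tree) → Ty (T.len + 1)
  | 0, _ => .star
  | n + 1, T =>
      let B := T.bdry n
      let b : Tm (B.len + 1) :=
        if B = Tree.disc n then .var (Fin.last _)
        else .coh B.ctx (unbTy n B) (Sub.ident _)
      .arr (b.sub (T.incl false n)) (unbTy n T) (b.sub (T.incl true n))

/-- The unbiased coherence `𝒞` of dimension `n` over a tree. -/
def unbCoh (n : ℕ) (T : Tree) : Tm (T.len + 1) :=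
  .coh T.ctx (unbTy n T) (Sub.ident _)

/-- The unbiased term `𝒯` of dimension `n` over a tree. -/
def unbTm (n : ℕ) (T : Tree) : Tm (T.len + 1) :=
  if T = Tree.disc n then .var (Fin.last _) else unbCoh n T

theorem unbTy_succ (n : ℕ) (T : Tree) :
    unbTy (n + 1) T = .arr ((unbTm n (T.bdry n)).sub (T.incl false n)) (unbTy n T)
      ((unbTm n (T.bdry n)).sub (T.incl true n)) := rfl

/-- The substitution `{A, t} : Dᵐ → Γ` of a type `A` of dimension `m` and a term `t`. The clause
for `⋆` at positive `m` is a junk value; there the dimension of `A` is not `m`. -/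
def discSub {n : ℕ} : (m : ℕ) → Ty n → Tm n → Sub ((Tree.disc m).len + 1) n
  | 0, _, t => fun _ => t
  | _ + 1, .star, t => fun _ => t
  | m + 1, .arr s A u, t =>
      Fin.snoc (α := fun _ => Tm n) (Fin.snoc (α := fun _ => Tm n) (discSub m A s) u) t

/-- The identity `𝟙⟦{A, s}⟧` on a term `s` of type `A`. -/
def idTm {n : ℕ} (A : Ty n) (s : Tm n) : Tm n :=
  (unbCoh (A.dim + 1) (Tree.disc A.dim)).sub (discSub A.dim A s)

/-- A term is an identity if it is the unbiased coherence of dimension `m + 1` over `Dᵐ`, under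
some substitution out of `Dᵐ` (such a substitution is the same thing as a type of dimension `m`
and a term). -/
def IsIdentity {n : ℕ} (t : Tm n) : Prop :=
  ∃ (m : ℕ) (σ : Sub ((Tree.disc m).len + 1) n),
    t = (unbCoh (m + 1) (Tree.disc m)).sub σ

/-! ### Branches and inserted trees -/

/-- Branches of a tree: non-empty lists `k :: P` of indices that lead to a linear subtree.
`here` is the list `[0]`, `inside P` is `0 :: P`, and `next` turns `k :: P` into `(k + 1) :: P`. -/
inductive Branch : Tree → Type
  | here (m : ℕ) (Ts : Tree) : Branch (.cons (.disc m) Ts)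
  | inside {S : Tree} (P : Branch S) (Ts : Tree) : Branch (.cons S Ts)
  | next (S : Tree) {Ts : Tree} (P : Branch Ts) : Branch (.cons S Ts)

namespace Branch

/-- The branch height, one less than the length of the list of indices. -/
def bh : {S : Tree} → Branch S → ℕ
  | _, here _ _ => 0
  | _, inside P _ => P.bh + 1
  | _, next _ P => P.bh

/-- The locally maximal variable at the end of a branch. -/
def leaf : {S : Tree} → Branch S → Fin (S.len + 1)
  | _, here m _ => wl (Fin.last (Tree.disc m).len).succ.succ
  | _, inside P _ => wl P.leaf.succ.succ
  | _, next _ P => wr 1 P.leaf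

/-- The leaf height, the dimension of the locally maximal variable at the end of a branch. -/
def lh : {S : Tree} → Branch S → ℕ
  | _, here m _ => m + 1
  | _, inside P _ => P.lh + 1
  | _, next _ P => P.lh

/-- The inserted tree, for a tree `T` whose trunk height is at least the branch height. -/
def ins : {S : Tree} → (P : Branch S) → (T : Tree) → P.bh ≤ T.th → Tree
  | _, here _ Ts, T, _ => T.append Ts
  | _, inside P Ts, .cons T .nil, h => .cons (P.ins T (Nat.le_of_succ_le_succ h)) Ts
  | _, inside _ _, .nil, h => absurd h (Nat.not_succ_le_zero _)
  | _, inside _ _, .cons _ (.cons _ _), h => absurd h (Nat.not_succ_le_zero _)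
  | _, next S P, T, h => .cons S (P.ins T h)

/-- The exterior substitution `κ` from `S` to the inserted tree. -/
def ext : {S : Tree} → (P : Branch S) → (T : Tree) → (h : P.bh ≤ T.th) →
    Sub (S.len + 1) ((P.ins T h).len + 1)
  | _, here m Ts, T, _ =>
      wedgeElim
        (Sub.comp (discSub (m + 1) (unbTy (m + 1) T) (unbCoh (m + 1) T))
          (Sub.ren (T.appendInl Ts)))
        (Sub.ren (T.appendInr Ts))
  | _, inside P _, .cons T .nil, h =>
      (P.ext T (Nat.le_of_succ_le_succ h)).susp.wedge 1 (Sub.ident _)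
  | _, inside _ _, .nil, h => absurd h (Nat.not_succ_le_zero _)
  | _, inside _ _, .cons _ (.cons _ _), h => absurd h (Nat.not_succ_le_zero _)
  | _, next S P, T, h => (Sub.ident (S.len + 2 + 1)).wedge 1 (P.ext T h)

end Branch

/-! ### Labellings and inserted substitutions -/

/-- Labellings of a tree by terms over a context of length `n`: `pt t₀` labels the empty tree, and
`cons t₀ L₁ R` is the labelling `t₀ L₁ t₁ ⋯ Lₖ tₖ`, where `R` is `t₁ L₂ ⋯ Lₖ tₖ`. -/
inductive Label (n : ℕ) : Tree → Type
  | pt (t : Tm n) : Label n .nil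
  | cons {T Ts : Tree} (t : Tm n) (L : Label n T) (R : Label n Ts) : Label n (.cons T Ts)

namespace Label

variable {n : ℕ}

/-- The first term `t₀` of a labelling. -/
def first : {T : Tree} → Label n T → Tm n
  | _, pt t => t
  | _, cons t _ _ => t

/-- Replace the first term of a labelling. -/
def setFirst (s : Tm n) : {T : Tree} → Label n T → Label n T
  | _, pt _ => pt s
  | _, cons _ L R => cons s L R

/-- The substitution out of the context of a tree that corresponds to a labelling. -/
def toSub : {T : Tree} → Label n T → Sub (T.len + 1) n
  | _, pt t => fun _ => t
  | _, cons t L R =>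
      wedgeElim
        (Fin.cases (motive := fun _ => Tm n) t
          (Fin.cases (motive := fun _ => Tm n) R.first L.toSub))
        R.toSub

/-- The labelling that corresponds to a substitution out of the context of a tree. -/
def ofSub : (T : Tree) → Sub (T.len + 1) n → Label n T
  | .nil, σ => pt (σ 0)
  | .cons T Ts, σ =>
      cons (σ 0) (ofSub T (fun i => σ (wl i.succ.succ))) (ofSub Ts (fun i => σ (wr 1 i)))

/-- Concatenation of labellings; the last term of the first one is kept, and the first term of the
second one is dropped. -/
def append : {T U : Tree} → Label n T → Label n U → Label n (T.append U)
  | _, _, pt t, M => M.setFirst t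
  | _, _, cons t L R, M => cons t L (R.append M)

/-- The inserted labelling. -/
def ins : {S : Tree} → (P : Branch S) → (T : Tree) → (h : P.bh ≤ T.th) →
    Label n S → Label n T → Label n (P.ins T h)
  | _, .here _ _, _, _, cons _ _ R, M => M.append R
  | _, .inside P _, .cons T .nil, h, cons _ L R, cons t M (pt u) =>
      cons t (ins P T (Nat.le_of_succ_le_succ h) L M) (R.setFirst u)
  | _, .inside _ _, .nil, h, _, _ => absurd h (Nat.not_succ_le_zero _)
  | _, .inside _ _, .cons _ (.cons _ _), h, _, _ => absurd h (Nat.not_succ_le_zero _)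
  | _, .next _ P, T, h, cons s L R, M => cons s L (ins P T h R M)

end Label

/-- The inserted substitution from the inserted tree to the common codomain of `σ` and `τ`. -/
def insSub {n : ℕ} {S : Tree} (P : Branch S) (T : Tree) (h : P.bh ≤ T.th)
    (σ : Sub (S.len + 1) n) (τ : Sub (T.len + 1) n) : Sub ((P.ins T h).len + 1) n :=
  (Label.ins P T h (Label.ofSub S σ) (Label.ofSub T τ)).toSub

/-! ### Typing and definitional equality over a set of equality generators -/

/-- Sets of equality generators `(Γ, s, t)`. -/
abbrev RuleSet : Type := ∀ ⦃n : ℕ⦄, Ctx n → Tm n → Tm n → Prop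

mutual

/-- `Γ ⊢`. -/
inductive WfCtx (R : RuleSet) : ∀ {n : ℕ}, Ctx n → Prop
  | nil : WfCtx R .nil
  | snoc {n : ℕ} {Γ : Ctx n} {A : Ty n} : WfCtx R Γ → WfTy R Γ A → WfCtx R (.snoc Γ A)

/-- `Γ ⊢ A`. -/
inductive WfTy (R : RuleSet) : ∀ {n : ℕ}, Ctx n → Ty n → Prop
  | star {n : ℕ} {Γ : Ctx n} : WfTy R Γ .star
  | arr {n : ℕ} {Γ : Ctx n} {s t : Tm n} {A : Ty n} :
      WfTy R Γ A → WfTm R Γ s A → WfTm R Γ t A → WfTy R Γ (.arr s A t)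

/-- `Γ ⊢ t : A`. The rule `comp` is the one for coherences whose source and target are supported
by the boundaries of codimension one (so the dimension of the pasting context is positive), and
`coh` is the one for coherences with full source and target. The pasting contexts are the contexts
of trees. -/
inductive WfTm (R : RuleSet) : ∀ {n : ℕ}, Ctx n → Tm n → Ty n → Prop
  | var {n : ℕ} {Γ : Ctx n} (x : Fin n) : WfCtx R Γ → WfTm R Γ (.var x) (Γ.lookup x)
  | comp {n : ℕ} {Γ : Ctx n} {T : Tree} {s t : Tm (T.len + 1)} {A : Ty (T.len + 1)}
      {σ : Sub (T.len + 1) n} (d : ℕ) :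
      T.dim = d + 1 →
      WfTy R T.ctx (.arr s A t) →
      WfSub R Γ T.ctx σ →
      s.supp T.ctx = (T.incl false d).supp T.ctx →
      t.supp T.ctx = (T.incl true d).supp T.ctx →
      WfTm R Γ (.coh T.ctx (.arr s A t) σ) ((Ty.arr s A t).sub σ)
  | coh {n : ℕ} {Γ : Ctx n} {T : Tree} {s t : Tm (T.len + 1)} {A : Ty (T.len + 1)}
      {σ : Sub (T.len + 1) n} :
      WfTy R T.ctx (.arr s A t) →
      WfSub R Γ T.ctx σ →
      s.supp T.ctx = Set.univ →
      t.supp T.ctx = Set.univ →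
      WfTm R Γ (.coh T.ctx (.arr s A t) σ) ((Ty.arr s A t).sub σ)
  | conv {n : ℕ} {Γ : Ctx n} {t : Tm n} {A B : Ty n} :
      WfTm R Γ t A → EqTy R Γ A B → WfTm R Γ t B

/-- `Γ ⊢ σ : Δ`. A substitution out of `Δ, A` is split into its restriction to `Δ` and its value
at the last variable. -/
inductive WfSub (R : RuleSet) : ∀ {m n : ℕ}, Ctx n → Ctx m → Sub m n → Prop
  | nil {n : ℕ} {Γ : Ctx n} (σ : Sub 0 n) : WfSub R Γ .nil σ
  | snoc {m n : ℕ} {Γ : Ctx n} {Δ : Ctx m} {A : Ty m} (σ : Sub (m + 1) n) :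
      WfSub R Γ Δ (fun i => σ i.castSucc) →
      WfTy R Δ A →
      WfTm R Γ (σ (Fin.last m)) (A.sub (fun i => σ i.castSucc)) →
      WfSub R Γ (.snoc Δ A) σ

/-- `Γ ⊢ s = t`, definitional equality of terms. Equality of substitutions, in the rule `coh`, is
equality of all components. -/
inductive EqTm (R : RuleSet) : ∀ {n : ℕ}, Ctx n → Tm n → Tm n → Prop
  | var {n : ℕ} {Γ : Ctx n} (x : Fin n) : EqTm R Γ (.var x) (.var x)
  | symm {n : ℕ} {Γ : Ctx n} {s t : Tm n} : EqTm R Γ s t → EqTm R Γ t s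
  | trans {n : ℕ} {Γ : Ctx n} {s t u : Tm n} : EqTm R Γ s t → EqTm R Γ t u → EqTm R Γ s u
  | coh {m n : ℕ} {Γ : Ctx n} {Δ : Ctx m} {A B : Ty m} {σ τ : Sub m n} :
      EqTy R Δ A B → (∀ i, EqTm R Γ (σ i) (τ i)) → EqTm R Γ (.coh Δ A σ) (.coh Δ B τ)
  | rule {n : ℕ} {Γ : Ctx n} {s t : Tm n} {A : Ty n} :
      R Γ s t → WfTm R Γ s A → EqTm R Γ s t

/-- `Γ ⊢ A = B`, definitional equality of types. -/
inductive EqTy (R : RuleSet) : ∀ {n : ℕ}, Ctx n → Ty n → Ty n → Prop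
  | star {n : ℕ} {Γ : Ctx n} : EqTy R Γ .star .star
  | arr {n : ℕ} {Γ : Ctx n} {s s' t t' : Tm n} {A A' : Ty n} :
      EqTm R Γ s s' → EqTm R Γ t t' → EqTy R Γ A A' → EqTy R Γ (.arr s A t) (.arr s' A' t')

end

/-! ### The equality generators of the theory -/

/-- `(S, P, T, Γ, σ, τ)` satisfies the conditions of an insertion redex: the branch height of `P`
is at most the trunk height of `T`, and `P⟦σ⟧` is the unbiased coherence over `T`, of dimension the
leaf height of `P`, under `τ`. (Validity of `σ` and `τ` in `Γ` is a typing judgement and is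
expressed by `WfSub`.) -/
structure InsertionRedex {n : ℕ} {S : Tree} (P : Branch S) (T : Tree)
    (σ : Sub (S.len + 1) n) (τ : Sub (T.len + 1) n) : Prop where
  bh_le_th : P.bh ≤ T.th
  leaf_eq : σ P.leaf = (unbCoh P.lh T).sub τ

/-- The generators of the theory with strict units and associators. -/
inductive sua : RuleSet
  /-- A unary composite, that is, the unbiased coherence of dimension `m` over `Dᵐ` under a
  substitution out of `Dᵐ`, is equal to its argument. -/
  | discRemoval {n : ℕ} (Γ : Ctx n) (m : ℕ) (σ : Sub ((Tree.disc m).len + 1) n) :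
      sua Γ ((unbCoh m (Tree.disc m)).sub σ) (σ (Fin.last _))
  /-- An endo-coherence that is not an identity is equal to an identity. -/
  | endoCoherenceRemoval {k n : ℕ} (Γ : Ctx n) (Δ : Ctx k) (s : Tm k) (A : Ty k) (σ : Sub k n) :
      ¬ IsIdentity (Tm.coh Δ (.arr s A s) σ) →
      sua Γ (.coh Δ (.arr s A s) σ) (idTm (A.sub σ) (s.sub σ))
  /-- Insertion of an unbiased composite or an identity into a coherence that is not an
  identity. -/
  | insertion {n : ℕ} (Γ : Ctx n) {S : Tree} (P : Branch S) (T : Tree) (A : Ty (S.len + 1))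
      (σ : Sub (S.len + 1) n) (τ : Sub (T.len + 1) n) (h : InsertionRedex P T σ τ) :
      (P.lh = T.dim ∨ IsIdentity (unbCoh P.lh T)) →
      ¬ IsIdentity (Tm.coh S.ctx A σ) →
      sua Γ (.coh S.ctx A σ)
        (.coh (P.ins T h.bh_le_th).ctx (A.sub (P.ext T h.bh_le_th))
          (insSub P T h.bh_le_th σ τ))

end CattSua

/-!
The coherence on the left and the unbiased coherence on the right have the same context and the same
substitution, so it suffices that the types `𝒰ⁿ_S⟦κ⟧` and `𝒰ⁿ_{S ≪ T}` are definitionally equal over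
`S ≪ T` (`LTree.InsTy.ext`). The redex enters only through `dim T ≤ lh P`, which follows from the
validity of `𝒞_T^{lh P}⟦τ⟧`, because the support of the source of a valid coherence reaches
codimension one (`dim_le_of_wfTm_unbCoh`).

*Labelled trees.* A tree together with a substitution out of its context is the same thing as a tree
labelled by terms (`LTree`). Restriction along a boundary inclusion becomes truncation
(`LTree.of_bdry`), so the unbiased type over a labelled tree is built from the unbiased terms over
its truncations (`LTree.uty_succ`), and a substitution is valid iff the labels are typed as the
globular shape requires (`LTree.typed_of_iff`). From this it follows, by induction on the
dimension, that unbiased types and terms are valid (`LTree.wfTy_wfTm_unb`).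

*Insertion as a relation.* `LTree.IsIns` says that a labelled tree `V` is the insertion of `T` into
`S`, where the labels of `S` along the branch are those of `{𝒰_T, 𝒞_T}`. The exterior substitution
`κ` gives such an `S` for the identity labelling `V` of `S ≪ T` (`LTree.exists_isIns_ext`). The
statement to prove becomes: if `V` is the insertion of `T` into `S`, then the unbiased types over
`S` and `V` agree (`LTree.insTy`). The proof is by induction on the dimension.

* The relation is stable under truncation up to disc removal (`LTree.IsIns.bdry`): the truncated
  branch ends in the unbiased term over a boundary of `T` instead of the unbiased coherence. Hence
  the types agree in dimension `n + 1` if the unbiased terms agree in dimension `n`.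
* For the terms (`LTree.InsTy.eqTm_utm`), if `S` is the disc of dimension `n` or `n - 1`, then
  `V = T`, and the claim is disc removal or endo-coherence removal. Otherwise the coherence over `S`
  is not an identity. If `dim T = lh P`, or if `T` is the disc of dimension `lh P - 1`, the
  insertion rule applies. If not, the unbiased coherence over `T` at the end of the branch is an
  endo-coherence, hence equal to an identity; insertion of that identity shortens the branch by one
  (`LTree.IsIns.prune`), and induction on `lh P` concludes.
-/

namespace CattSua

/-! ### Substitution and suspension of raw expressions -/

theorem Tm.sub_sub {l m n : ℕ} (σ : Sub l m) (τ : Sub m n) :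
    ∀ t : Tm l, (t.sub σ).sub τ = t.sub (σ.comp τ)
  | .var _ => rfl
  | .coh Δ A ρ => by
      simp only [Tm.sub]
      congr 1
      funext i
      exact Tm.sub_sub σ τ (ρ i)

theorem Ty.sub_sub {l m n : ℕ} (σ : Sub l m) (τ : Sub m n) :
    ∀ A : Ty l, (A.sub σ).sub τ = A.sub (σ.comp τ)
  | .star => rfl
  | .arr s A t => by
      simp only [Ty.sub, Tm.sub_sub]
      rw [Ty.sub_sub σ τ A]

theorem Tm.sub_ident {n : ℕ} : ∀ t : Tm n, t.sub (Sub.ident n) = t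
  | .var _ => rfl
  | .coh Δ A ρ => by
      simp only [Tm.sub]
      congr 1
      funext i
      exact Tm.sub_ident (ρ i)

theorem Ty.sub_ident {n : ℕ} : ∀ A : Ty n, A.sub (Sub.ident n) = A
  | .star => rfl
  | .arr s A t => by
      simp only [Ty.sub, Tm.sub_ident]
      rw [Ty.sub_ident A]

theorem Sub.comp_ident {m n : ℕ} (σ : Sub m n) : σ.comp (Sub.ident n) = σ :=
  funext fun i => Tm.sub_ident (σ i)

theorem Sub.ren_comp {l m n : ℕ} (f : Fin l → Fin m) (σ : Sub m n) :
    (Sub.ren f).comp σ = fun i => σ (f i) := rfl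

@[simp] theorem Sub.susp_succ {m n : ℕ} (σ : Sub m n) (i : Fin m) :
    σ.susp i.succ.succ = (σ i).susp := rfl

/-- Case distinction on the variables of a suspension. -/
theorem suspCases {n : ℕ} {p : Fin (n + 2) → Prop} (h0 : p 0) (h1 : p 1)
    (hs : ∀ i : Fin n, p i.succ.succ) (i : Fin (n + 2)) : p i := by
  refine Fin.cases h0 (fun j => ?_) i
  exact Fin.cases h1 hs j

theorem Tm.susp_coh {k n : ℕ} (Δ : Ctx k) (A : Ty k) (σ : Sub k n) :
    (Tm.coh Δ A σ).susp = .coh Δ.susp A.susp σ.susp := by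
  rw [Tm.susp]; rfl

theorem Tm.susp_sub {m n : ℕ} (σ : Sub m n) :
    ∀ t : Tm m, (t.sub σ).susp = t.susp.sub σ.susp
  | .var x => by simp [Tm.sub, Tm.susp]
  | .coh Δ A ρ => by
      rw [Tm.sub, Tm.susp_coh, Tm.susp_coh, Tm.sub]
      congr 1
      funext i
      induction i using suspCases with
      | h0 => rfl
      | h1 => rfl
      | hs j => exact Tm.susp_sub σ (ρ j)

theorem Ty.susp_sub {m n : ℕ} (σ : Sub m n) :
    ∀ A : Ty m, (A.sub σ).susp = A.susp.sub σ.susp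
  | .star => rfl
  | .arr s A t => by
      simp only [Ty.sub, Ty.susp, Tm.susp_sub]
      rw [Ty.susp_sub σ A]

theorem Sub.susp_ident (n : ℕ) : (Sub.ident n).susp = Sub.ident (n + 2) := by
  funext i
  induction i using suspCases with
  | h0 => rfl
  | h1 => rfl
  | hs j => simp [Sub.ident, Tm.susp]

/-! ### Variables of wedge sums -/

@[simp] theorem wr_zero {n m : ℕ} (p : Fin (n + 1)) : wr (m := m) p 0 = wl p := rfl

@[simp] theorem wedgeElim_wl {X : Type} {n m : ℕ} (f : Fin (n + 1) → X) (g : Fin (m + 1) → X)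
    (i : Fin (n + 1)) : wedgeElim f g (wl i) = f i := by
  have h : ((wl i : Fin (n + m + 1)) : ℕ) < n + 1 := i.2
  rw [wedgeElim, dif_pos h]
  rfl

@[simp] theorem wedgeElim_wr_succ {X : Type} {n m : ℕ} (f : Fin (n + 1) → X)
    (g : Fin (m + 1) → X) (p : Fin (n + 1)) (j : Fin m) :
    wedgeElim f g (wr p j.succ) = g j.succ := by
  have h : ¬ ((wr p j.succ : Fin (n + m + 1)) : ℕ) < n + 1 := by
    simp [wr]; omega
  rw [wedgeElim, dif_neg h]
  refine congrArg g (Fin.ext ?_)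
  simp [wr]
  omega

theorem wedgeElim_wr {X : Type} {n m : ℕ} (f : Fin (n + 1) → X)
    (g : Fin (m + 1) → X) (p : Fin (n + 1)) (h : f p = g 0) (j : Fin (m + 1)) :
    wedgeElim f g (wr p j) = g j := by
  refine Fin.cases ?_ (fun j => ?_) j
  · simpa using h
  · simp

/-- Case distinction on the variables of a wedge sum. -/
theorem wedgeCases {n m : ℕ} (p : Fin (n + 1)) {q : Fin (n + m + 1) → Prop}
    (hl : ∀ i, q (wl i)) (hr : ∀ j : Fin m, q (wr p j.succ)) (i : Fin (n + m + 1)) : q i := by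
  by_cases h : (i : ℕ) < n + 1
  · exact hl ⟨i, h⟩
  · have : i = wr p (Fin.succ ⟨i - (n + 1), by omega⟩) := by
      ext
      simp [wr]; omega
    rw [this]
    exact hr _

theorem Sub.ren_wl_zero {n : ℕ} :
    (Sub.ren (wl (n := n) (m := 0))) = Sub.ident (n + 1) := rfl

theorem wedgeElim_zero {X : Type} {n : ℕ} (f : Fin (n + 1) → X) (g : Fin (0 + 1) → X) :
    wedgeElim f g = f := by
  funext i
  exact wedgeElim_wl f g i

theorem Sub.wedge_zero {n n' : ℕ} (σ : Sub (n + 1) (n' + 1)) (p : Fin (n' + 1))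
    (τ : Sub (0 + 1) (0 + 1)) : Sub.wedge σ p τ = σ := by
  rw [Sub.wedge, wedgeElim_zero, Sub.ren_wl_zero]
  exact Sub.comp_ident σ

theorem Ctx.wedge_zero {n : ℕ} (Γ : Ctx (n + 1)) (p : Fin (n + 1)) (Δ : Ctx (0 + 1)) :
    Γ.wedge p Δ = Γ := by
  rw [Ctx.wedge]

theorem Tree.ctx_cons_nil (T : Tree) : (Tree.cons T .nil).ctx = T.ctx.susp := by
  rw [Tree.ctx, Tree.ctx]; exact Ctx.wedge_zero _ _ _

theorem Tree.incl_cons_nil (ε : Bool) (T : Tree) (n : ℕ) :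
    (Tree.cons T .nil).incl ε (n + 1) = (T.incl ε n).susp := by
  rw [Tree.incl]; exact Sub.wedge_zero _ _ _

/-! ### Suspension of unbiased expressions -/

theorem susp_unbTm_of {n : ℕ} {T : Tree}
    (h : (unbTy n T).susp = unbTy (n + 1) (.cons T .nil)) :
    (unbTm n T).susp = unbTm (n + 1) (.cons T .nil) := by
  by_cases hT : T = Tree.disc n
  · subst hT
    have h' : Tree.cons (Tree.disc n) .nil = Tree.disc (n + 1) := rfl
    rw [unbTm, if_pos rfl, unbTm, if_pos h', Tm.susp]
    rfl
  · have h' : ¬ Tree.cons T .nil = Tree.disc (n + 1) := by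
      simpa [Tree.disc] using hT
    rw [unbTm, if_neg hT, unbTm, if_neg h', unbCoh, unbCoh, Tm.susp_coh, h, Sub.susp_ident,
      Tree.ctx_cons_nil]
    rfl

theorem susp_unbTy : ∀ (n : ℕ) (T : Tree), (unbTy n T).susp = unbTy (n + 1) (.cons T .nil)
  | 0, T => by
      rw [unbTy_succ]
      simp only [unbTy, Ty.susp, Tree.bdry]
      congr 1
  | n + 1, T => by
      rw [unbTy_succ, unbTy_succ, Ty.susp, Tm.susp_sub, Tm.susp_sub,
        susp_unbTm_of (susp_unbTy n _), susp_unbTy n T, Tree.incl_cons_nil, Tree.incl_cons_nil]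
      rfl

theorem susp_unbTm (n : ℕ) (T : Tree) : (unbTm n T).susp = unbTm (n + 1) (.cons T .nil) :=
  susp_unbTm_of (susp_unbTy n T)

theorem susp_unbCoh (n : ℕ) (T : Tree) : (unbCoh n T).susp = unbCoh (n + 1) (.cons T .nil) := by
  rw [unbCoh, unbCoh, Tm.susp_coh, susp_unbTy, Sub.susp_ident, Tree.ctx_cons_nil]
  rfl

/-! ### Types of variables in pasting contexts -/

theorem Ctx.lookup_last {n : ℕ} (Γ : Ctx n) (A : Ty n) :
    (Ctx.snoc Γ A).lookup (Fin.last n) = A.sub (Sub.ren Fin.castSucc) := by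
  rw [Ctx.lookup, Fin.lastCases_last]

theorem Ctx.lookup_castSucc {n : ℕ} (Γ : Ctx n) (A : Ty n) (i : Fin n) :
    (Ctx.snoc Γ A).lookup i.castSucc = (Γ.lookup i).sub (Sub.ren Fin.castSucc) := by
  rw [Ctx.lookup, Fin.lastCases_castSucc]

/-- Suspension of renamings. -/
def suspRen {m n : ℕ} (f : Fin m → Fin n) : Fin (m + 2) → Fin (n + 2) :=
  Fin.cases 0 (Fin.cases 1 fun i => (f i).succ.succ)

theorem Sub.susp_ren {m n : ℕ} (f : Fin m → Fin n) :
    (Sub.ren f).susp = Sub.ren (suspRen f) := by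
  funext i
  induction i using suspCases with
  | h0 => rfl
  | h1 => rfl
  | hs j => simp [Sub.ren, suspRen, Tm.susp]

theorem suspRen_castSucc {n : ℕ} : suspRen (Fin.castSucc (n := n)) = Fin.castSucc := by
  funext i
  induction i using suspCases with
  | h0 => rfl
  | h1 => rfl
  | hs j => rfl

theorem Ctx.lookup_susp_zero : ∀ {n : ℕ} (Γ : Ctx n), Γ.susp.lookup 0 = .star
  | _, .nil => by
      rw [Ctx.susp]
      exact (Ctx.lookup_castSucc _ _ 0).trans (by
        rw [show (0 : Fin 1) = Fin.last 0 from rfl, Ctx.lookup_last]; rfl)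
  | _, .snoc Γ A => by
      rw [Ctx.susp]
      exact (Ctx.lookup_castSucc _ _ 0).trans (by rw [Ctx.lookup_susp_zero Γ]; rfl)

theorem Ctx.lookup_susp_one : ∀ {n : ℕ} (Γ : Ctx n), Γ.susp.lookup 1 = .star
  | _, .nil => by
      rw [Ctx.susp]
      exact (Ctx.lookup_last _ _).trans rfl
  | _, .snoc Γ A => by
      rw [Ctx.susp]
      exact (Ctx.lookup_castSucc _ _ 1).trans (by rw [Ctx.lookup_susp_one Γ]; rfl)

theorem Ctx.lookup_susp_succ : ∀ {n : ℕ} (Γ : Ctx n) (i : Fin n),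
    Γ.susp.lookup i.succ.succ = (Γ.lookup i).susp
  | _, .nil, i => i.elim0
  | _, .snoc (n := n) Γ A, i => by
      rw [Ctx.susp]
      induction i using Fin.lastCases with
      | last =>
        rw [Ctx.lookup_last, Ty.susp_sub, Sub.susp_ren, suspRen_castSucc]
        exact Ctx.lookup_last _ _
      | cast i =>
        rw [Ctx.lookup_castSucc, Ty.susp_sub, Sub.susp_ren, suspRen_castSucc,
          ← Ctx.lookup_susp_succ Γ i]
        exact Ctx.lookup_castSucc _ _ i.succ.succ

theorem Ctx.lookup_wedge_wl {n : ℕ} (Γ : Ctx (n + 1)) (p : Fin (n + 1)) :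
    ∀ {m : ℕ} (Δ : Ctx (m + 1)) (i : Fin (n + 1)),
      (Γ.wedge p Δ).lookup (wl i) = (Γ.lookup i).sub (Sub.ren wl)
  | 0, Δ, i => by
      rw [Ctx.wedge_zero, Sub.ren_wl_zero, Ty.sub_ident]
      rfl
  | m + 1, .snoc Δ A, i => by
      rw [Ctx.wedge]
      refine (Ctx.lookup_castSucc _ _ (wl i)).trans ?_
      rw [Ctx.lookup_wedge_wl Γ p Δ i, Ty.sub_sub]
      rfl

theorem Ctx.lookup_wedge_wr {n : ℕ} (Γ : Ctx (n + 1)) (p : Fin (n + 1)) :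
    ∀ {m : ℕ} (Δ : Ctx (m + 1)) (j : Fin m),
      (Γ.wedge p Δ).lookup (wr p j.succ) = (Δ.lookup j.succ).sub (Sub.ren (wr p))
  | 0, _, j => j.elim0
  | m + 1, .snoc Δ A, j => by
      have hc : (Sub.ren (wr p)).comp (Sub.ren Fin.castSucc) =
          (Sub.ren Fin.castSucc).comp (Sub.ren (wr (m := m + 1) p)) := by
        funext i
        refine Fin.cases rfl (fun i => rfl) i
      rw [Ctx.wedge]
      induction j using Fin.lastCases with
      | last =>
        have e : (wr p (Fin.last m).succ : Fin (n + (m + 1) + 1)) = Fin.last _ := by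
          refine Fin.ext ?_
          change n + 1 + m = n + (m + 1)
          omega
        rw [e]
        refine (Ctx.lookup_last _ _).trans ?_
        rw [Fin.succ_last, Ctx.lookup_last, Ty.sub_sub, Ty.sub_sub, hc]
      | cast j =>
        refine (Ctx.lookup_castSucc _ _ (wr p j.succ)).trans ?_
        rw [Ctx.lookup_wedge_wr Γ p Δ j, ← Fin.castSucc_succ, Ctx.lookup_castSucc, Ty.sub_sub,
          Ty.sub_sub, hc]

theorem Tree.lookup_zero : ∀ T : Tree, T.ctx.lookup 0 = .star
  | .nil => by
      rw [Tree.ctx]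
      exact (Ctx.lookup_last _ _).trans rfl
  | .cons T Ts => by
      rw [Tree.ctx]
      refine (Ctx.lookup_wedge_wl _ _ _ 0).trans ?_
      rw [Ctx.lookup_susp_zero]; rfl

theorem Tree.lookup_cons_zero (T Ts : Tree) :
    (Tree.cons T Ts).ctx.lookup (wl 0) = .star := Tree.lookup_zero (.cons T Ts)

theorem Tree.lookup_cons_one (T Ts : Tree) :
    (Tree.cons T Ts).ctx.lookup (wl 1) = .star := by
  rw [Tree.ctx]
  refine (Ctx.lookup_wedge_wl _ _ _ 1).trans ?_
  rw [Ctx.lookup_susp_one]; rfl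

theorem Tree.lookup_cons_wl (T Ts : Tree) (i : Fin (T.len + 1)) :
    (Tree.cons T Ts).ctx.lookup (wl i.succ.succ) =
      (T.ctx.lookup i).susp.sub (Sub.ren wl) := by
  rw [Tree.ctx]
  refine (Ctx.lookup_wedge_wl _ _ _ i.succ.succ).trans ?_
  rw [Ctx.lookup_susp_succ]

theorem Tree.lookup_cons_wr (T Ts : Tree) (i : Fin (Ts.len + 1)) :
    (Tree.cons T Ts).ctx.lookup (wr 1 i) = (Ts.ctx.lookup i).sub (Sub.ren (wr 1)) := by
  refine Fin.cases ?_ (fun j => ?_) i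
  · rw [Tree.lookup_zero]
    exact Tree.lookup_cons_one T Ts
  · rw [Tree.ctx]
    exact Ctx.lookup_wedge_wr _ _ _ j

/-- Case distinction on the variables of the context of a tree. -/
theorem Tree.consCases {T Ts : Tree} {q : Fin ((Tree.cons T Ts).len + 1) → Prop}
    (h0 : q (wl 0)) (hl : ∀ i : Fin (T.len + 1), q (wl i.succ.succ))
    (hr : ∀ i : Fin (Ts.len + 1), q (wr 1 i)) (i : Fin ((Tree.cons T Ts).len + 1)) : q i := by
  refine wedgeCases (n := T.len + 2) (m := Ts.len) 1 (fun i => ?_) (fun j => hr j.succ) i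
  induction i using suspCases with
  | h0 => exact h0
  | h1 => exact hr 0
  | hs j => exact hl j

/-! ### Globular types: all terms are variables -/

/-- A type over `Γ` that is well formed and built from variables only. -/
inductive Ctx.Glob {n : ℕ} (Γ : Ctx n) : Ty n → Prop
  | star : Γ.Glob .star
  | arr {A : Ty n} (x y : Fin n) : Γ.Glob A → Γ.lookup x = A → Γ.lookup y = A →
      Γ.Glob (.arr (.var x) A (.var y))

theorem Ctx.Glob.ren {m n : ℕ} {Γ : Ctx m} {Δ : Ctx n} {f : Fin m → Fin n}
    (hf : ∀ x, Δ.lookup (f x) = (Γ.lookup x).sub (Sub.ren f)) {A : Ty m} (h : Γ.Glob A) :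
    Δ.Glob (A.sub (Sub.ren f)) := by
  induction h with
  | star => exact .star
  | arr x y _ hx hy ih =>
    exact .arr (f x) (f y) ih (by rw [hf, hx]) (by rw [hf, hy])

theorem Ctx.Glob.susp {n : ℕ} {Γ : Ctx n} {A : Ty n} (h : Γ.Glob A) : Γ.susp.Glob A.susp := by
  induction h with
  | star =>
    rw [Ty.susp]
    exact .arr 0 1 .star (Ctx.lookup_susp_zero Γ) (Ctx.lookup_susp_one Γ)
  | arr x y _ hx hy ih =>
    rw [Ty.susp, Tm.susp, Tm.susp]
    exact .arr _ _ ih (by rw [Ctx.lookup_susp_succ, hx]) (by rw [Ctx.lookup_susp_succ, hy])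

/-- A context all of whose types are globular. -/
inductive Ctx.IsGlob : ∀ {n : ℕ}, Ctx n → Prop
  | nil : Ctx.IsGlob .nil
  | snoc {n : ℕ} {Γ : Ctx n} {A : Ty n} : Γ.IsGlob → Γ.Glob A → Ctx.IsGlob (.snoc Γ A)

theorem Ctx.IsGlob.susp {n : ℕ} {Γ : Ctx n} (h : Γ.IsGlob) : Γ.susp.IsGlob := by
  induction h with
  | nil => rw [Ctx.susp]; exact .snoc (.snoc .nil .star) .star
  | snoc _ hA ih => rw [Ctx.susp]; exact .snoc ih hA.susp

theorem Ctx.IsGlob.wedge {n : ℕ} {Γ : Ctx (n + 1)} (hΓ : Γ.IsGlob) {p : Fin (n + 1)}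
    (hp : Γ.lookup p = .star) : ∀ {m : ℕ} {Δ : Ctx (m + 1)}, Δ.IsGlob →
      Δ.lookup 0 = .star → (Γ.wedge p Δ).IsGlob
  | 0, Δ, _, _ => by rw [Ctx.wedge_zero]; exact hΓ
  | m + 1, .snoc Δ A, .snoc hΔ hA, h0 => by
      have h0' : Δ.lookup 0 = .star := by
        have := (Ctx.lookup_castSucc Δ A 0).symm.trans h0
        revert this
        cases Δ.lookup 0 with
        | star => exact fun _ => rfl
        | arr s A t => intro h; simp [Ty.sub] at h
      rw [Ctx.wedge]
      refine .snoc (hΓ.wedge hp hΔ h0') (hA.ren fun x => ?_)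
      refine Fin.cases ?_ (fun j => ?_) x
      · rw [wr_zero, Ctx.lookup_wedge_wl, hp, h0']; rfl
      · exact Ctx.lookup_wedge_wr _ _ _ j

theorem Tree.isGlob_ctx : ∀ T : Tree, T.ctx.IsGlob
  | .nil => by rw [Tree.ctx]; exact .snoc .nil .star
  | .cons T Ts => by
      rw [Tree.ctx]
      exact T.isGlob_ctx.susp.wedge (Ctx.lookup_susp_one _) Ts.isGlob_ctx Ts.lookup_zero

theorem Ctx.IsGlob.lookup {n : ℕ} {Γ : Ctx n} (h : Γ.IsGlob) (x : Fin n) :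
    Γ.Glob (Γ.lookup x) := by
  induction h with
  | nil => exact x.elim0
  | @snoc n Γ A _ hA ih =>
    induction x using Fin.lastCases with
    | last => rw [Ctx.lookup_last]; exact hA.ren fun x => Ctx.lookup_castSucc _ _ _
    | cast i => rw [Ctx.lookup_castSucc]; exact (ih i).ren fun x => Ctx.lookup_castSucc _ _ _

theorem Tree.glob_lookup (T : Tree) (x : Fin (T.len + 1)) : T.ctx.Glob (T.ctx.lookup x) :=
  T.isGlob_ctx.lookup x

variable {R : RuleSet}

theorem Ctx.Glob.wfTy {n : ℕ} {Γ : Ctx n} (hΓ : WfCtx R Γ) {A : Ty n} (h : Γ.Glob A) :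
    WfTy R Γ A := by
  induction h with
  | star => exact .star
  | arr x y _ hx hy ih => exact .arr ih (hx ▸ .var x hΓ) (hy ▸ .var y hΓ)

theorem Ctx.IsGlob.wfCtx {n : ℕ} {Γ : Ctx n} (h : Γ.IsGlob) : WfCtx R Γ := by
  induction h with
  | nil => exact .nil
  | snoc _ hA ih => exact .snoc ih (hA.wfTy ih)

theorem Tree.wfCtx (T : Tree) : WfCtx R T.ctx := T.isGlob_ctx.wfCtx

/-- A substitution is valid if it sends each variable to a term of the appropriate type. -/
theorem WfSub.of_lookup {n : ℕ} {Γ : Ctx n} : ∀ {m : ℕ} {Δ : Ctx m}, WfCtx R Δ →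
    ∀ {σ : Sub m n}, (∀ x, WfTm R Γ (σ x) ((Δ.lookup x).sub σ)) → WfSub R Γ Δ σ
  | _, .nil, _, σ, _ => .nil σ
  | _, .snoc Δ A, .snoc hΔ hA, σ, h => by
      refine .snoc σ (WfSub.of_lookup hΔ fun x => ?_) hA ?_
      · have := h x.castSucc
        rwa [Ctx.lookup_castSucc, Ty.sub_sub, Sub.ren_comp] at this
      · have := h (Fin.last _)
        rwa [Ctx.lookup_last, Ty.sub_sub, Sub.ren_comp] at this

theorem WfSub.exists_wfTm {n : ℕ} {Γ : Ctx n} : ∀ {m : ℕ} {Δ : Ctx m} {σ : Sub m n},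
    WfSub R Γ Δ σ → ∀ x : Fin m, ∃ A, WfTm R Γ (σ x) A
  | _, .nil, _, _, x => x.elim0
  | _, .snoc Δ A, σ, .snoc _ h1 _ h2, x => by
      induction x using Fin.lastCases with
      | last => exact ⟨_, h2⟩
      | cast i => exact h1.exists_wfTm i

/-! ### Labelled trees -/

/-- Trees labelled by terms over a context of length `k`; `cons t L R` is the labelling
`t L t₁ ⋯ Lₘ tₘ` where `R` is `t₁ ⋯ Lₘ tₘ`. In contrast to `Label`, the underlying tree is not an
index of the type, so a labelled tree is a tree together with a substitution out of its context,
and labellings of different trees can be compared without transport. -/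
inductive LTree (k : ℕ) : Type
  | pt (t : Tm k) : LTree k
  | cons (t : Tm k) (L R : LTree k) : LTree k

namespace LTree

variable {k : ℕ}

/-- The underlying tree. -/
def shape : LTree k → Tree
  | pt _ => .nil
  | cons _ L R => .cons L.shape R.shape

/-- The first label of type `⋆`. -/
def first : LTree k → Tm k
  | pt t => t
  | cons t _ _ => t

/-- The last label of type `⋆`. -/
def last : LTree k → Tm k
  | pt t => t
  | cons _ _ R => R.last

/-- Replace the first label. -/
def setFirst (s : Tm k) : LTree k → LTree k
  | pt _ => pt s
  | cons _ L R => cons s L R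

/-- Concatenation; the first label of the second tree is dropped. -/
def append : LTree k → LTree k → LTree k
  | pt t, M => M.setFirst t
  | cons t L R, M => cons t L (R.append M)

/-- The substitution out of the context of the underlying tree. -/
def toSub : (L : LTree k) → Sub (L.shape.len + 1) k
  | pt t => fun _ => t
  | cons t L R =>
      wedgeElim
        (Fin.cases (motive := fun _ => Tm k) t
          (Fin.cases (motive := fun _ => Tm k) R.first L.toSub))
        R.toSub

/-- The labelled tree given by a tree and a substitution out of its context. -/
def of : (T : Tree) → Sub (T.len + 1) k → LTree k
  | .nil, σ => pt (σ 0)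
  | .cons T Ts, σ =>
      cons (σ 0) (of T (fun i => σ (wl i.succ.succ))) (of Ts (fun i => σ (wr 1 i)))

/-- Truncation of a labelled tree at height `n`, keeping the labels of the source (`ε = false`) or
of the target (`ε = true`). -/
def bdry (ε : Bool) : LTree k → ℕ → LTree k
  | pt t, _ => pt t
  | cons t L R, 0 => pt (if ε then (cons t L R).last else t)
  | cons t L R, n + 1 => cons t (L.bdry ε n) (R.bdry ε (n + 1))

/-- Relabelling along a function on terms. -/
def map {l : ℕ} (f : Tm k → Tm l) : LTree k → LTree l
  | pt t => pt (f t)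
  | cons t L R => cons (f t) (L.map f) (R.map f)

@[simp] theorem first_setFirst (s : Tm k) (L : LTree k) : (L.setFirst s).first = s := by
  cases L <;> rfl

@[simp] theorem setFirst_first (L : LTree k) : L.setFirst L.first = L := by
  cases L <;> rfl

@[simp] theorem first_map {l : ℕ} (f : Tm k → Tm l) (L : LTree k) :
    (L.map f).first = f L.first := by
  cases L <;> rfl

@[simp] theorem last_map {l : ℕ} (f : Tm k → Tm l) : ∀ L : LTree k,
    (L.map f).last = f L.last
  | pt _ => rfl
  | cons _ _ R => last_map f R

@[simp] theorem shape_map {l : ℕ} (f : Tm k → Tm l) : ∀ L : LTree k, (L.map f).shape = L.shape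
  | pt _ => rfl
  | cons _ L R => by simp [map, shape, shape_map f L, shape_map f R]

theorem setFirst_map {l : ℕ} (f : Tm k → Tm l) (s : Tm k) (L : LTree k) :
    (L.setFirst s).map f = (L.map f).setFirst (f s) := by
  cases L <;> rfl

theorem append_map {l : ℕ} (f : Tm k → Tm l) (M : LTree k) : ∀ L : LTree k,
    (L.append M).map f = (L.map f).append (M.map f)
  | pt _ => setFirst_map f _ M
  | cons _ L R => by simp [map, append, append_map f M R]

theorem first_append : ∀ L M : LTree k, (L.append M).first = L.first
  | pt _, M => first_setFirst _ M
  | cons _ _ _, _ => rfl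

@[simp] theorem toSub_cons_zero (t : Tm k) (L R : LTree k) : (cons t L R).toSub (wl 0) = t :=
  wedgeElim_wl _ _ _

@[simp] theorem toSub_cons_wl (t : Tm k) (L R : LTree k) (i : Fin (L.shape.len + 1)) :
    (cons t L R).toSub (wl i.succ.succ) = L.toSub i := wedgeElim_wl _ _ _

theorem toSub_zero (L : LTree k) : L.toSub 0 = L.first := by
  cases L with
  | pt t => rfl
  | cons t L R => exact toSub_cons_zero t L R

@[simp] theorem toSub_cons_wr (t : Tm k) (L R : LTree k) (i : Fin (R.shape.len + 1)) :
    (cons t L R).toSub (wr 1 i) = R.toSub i :=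
  wedgeElim_wr _ _ _ (toSub_zero R).symm i

theorem first_of (T : Tree) (σ : Sub (T.len + 1) k) : (of T σ).first = σ 0 := by
  cases T <;> rfl

theorem of_shape_toSub : ∀ L : LTree k, of L.shape L.toSub = L
  | pt _ => rfl
  | cons t L R => by
      change cons ((cons t L R).toSub (wl 0)) (of _ _) (of _ _) = _
      simp only [toSub_cons_wl, toSub_cons_wr, toSub_cons_zero]
      rw [of_shape_toSub L, of_shape_toSub R]

/-- The passage from a tree with a substitution to a labelled tree loses nothing. -/
theorem mk_shape_toSub_of : ∀ (T : Tree) (σ : Sub (T.len + 1) k),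
    (⟨(of T σ).shape, (of T σ).toSub⟩ : Σ T : Tree, Sub (T.len + 1) k) = ⟨T, σ⟩
  | .nil, σ => by
      refine congrArg (Sigma.mk Tree.nil) ?_
      funext i
      exact congrArg σ (Subsingleton.elim (α := Fin 1) 0 i)
  | .cons T Ts, σ => by
      have h1 := mk_shape_toSub_of T (fun i => σ (wl i.succ.succ))
      have h2 := mk_shape_toSub_of Ts (fun i => σ (wr 1 i))
      have hf := first_of Ts (fun i => σ (wr 1 i))
      rw [of]
      generalize of T (fun i => σ (wl i.succ.succ)) = L at *
      generalize of Ts (fun i => σ (wr 1 i)) = R at *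
      obtain ⟨rfl, h1⟩ := Sigma.mk.inj_iff.mp h1
      obtain ⟨rfl, h2⟩ := Sigma.mk.inj_iff.mp h2
      refine congrArg (Sigma.mk (Tree.cons L.shape R.shape)) ?_
      funext i
      induction i using Tree.consCases with
      | h0 => exact toSub_cons_zero _ _ _
      | hl i => exact (toSub_cons_wl _ _ _ i).trans (congrFun (eq_of_heq h1) i)
      | hr i => exact (toSub_cons_wr _ _ _ i).trans (congrFun (eq_of_heq h2) i)

theorem shape_of (T : Tree) (σ : Sub (T.len + 1) k) : (of T σ).shape = T :=
  congrArg Sigma.fst (mk_shape_toSub_of T σ)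

theorem of_map {l : ℕ} (f : Tm k → Tm l) : ∀ (T : Tree) (σ : Sub (T.len + 1) k),
    (of T σ).map f = of T (fun i => f (σ i))
  | .nil, _ => rfl
  | .cons T Ts, σ => by
      simp only [of, map]
      rw [of_map f T, of_map f Ts]

theorem map_sub (L : LTree k) {l : ℕ} (ρ : Sub k l) :
    L.map (fun t => t.sub ρ) = of L.shape (L.toSub.comp ρ) := by
  conv_lhs => rw [← of_shape_toSub L]
  exact of_map _ _ _

theorem shape_bdry (ε : Bool) : ∀ (L : LTree k) (n : ℕ), (L.bdry ε n).shape = L.shape.bdry n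
  | pt _, n => by simp [bdry, shape, Tree.bdry]
  | cons _ _ _, 0 => rfl
  | cons _ L R, n + 1 => by simp [bdry, shape, Tree.bdry, shape_bdry ε L, shape_bdry ε R]

theorem first_bdry_succ (ε : Bool) (L : LTree k) (n : ℕ) :
    (L.bdry ε (n + 1)).first = L.first := by
  cases L <;> rfl

theorem last_bdry_succ (ε : Bool) : ∀ (L : LTree k) (n : ℕ), (L.bdry ε (n + 1)).last = L.last
  | pt _, _ => rfl
  | cons _ _ R, n => last_bdry_succ ε R n

theorem bdry_zero (ε : Bool) (L : LTree k) :
    L.bdry ε 0 = pt (if ε then L.last else L.first) := by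
  cases L with
  | pt t => cases ε <;> rfl
  | cons t L R => rfl

/-- Globularity of truncations. -/
theorem bdry_bdry (ε ε' : Bool) : ∀ (L : LTree k) {m n : ℕ}, m < n →
    (L.bdry ε n).bdry ε' m = L.bdry ε' m
  | pt _, _, _, _ => rfl
  | cons t L R, 0, n + 1, _ => by
      rw [bdry_zero, bdry_zero, first_bdry_succ, last_bdry_succ]
  | cons t L R, m + 1, n + 1, h => by
      simp only [bdry]
      rw [bdry_bdry ε ε' L (Nat.lt_of_succ_lt_succ h), bdry_bdry ε ε' R h]

theorem bdry_eq_self (ε : Bool) : ∀ (L : LTree k) {n : ℕ}, L.shape.dim ≤ n → L.bdry ε n = L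
  | pt _, _, _ => rfl
  | cons t L R, 0, h => by simp [shape, Tree.dim] at h
  | cons t L R, n + 1, h => by
      simp only [shape, Tree.dim, max_le_iff, Nat.add_le_add_iff_right] at h
      rw [bdry, bdry_eq_self ε L h.1, bdry_eq_self ε R h.2]

theorem bdry_append_succ (ε : Bool) (M : LTree k) (n : ℕ) : ∀ L : LTree k,
    (L.append M).bdry ε (n + 1) = (L.bdry ε (n + 1)).append (M.bdry ε (n + 1))
  | pt _ => by cases M <;> rfl
  | cons t L R => by
      simp only [append, bdry]
      rw [bdry_append_succ ε M n R]

theorem last_append (M : LTree k) : ∀ L : LTree k, M.first = L.last →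
    (L.append M).last = M.last
  | pt _, h => by
      cases M with
      | pt _ => exact h.symm
      | cons _ _ _ => rfl
  | cons _ _ R, h => last_append M R h

theorem bdry_map {l : ℕ} (f : Tm k → Tm l) (ε : Bool) : ∀ (L : LTree k) (n : ℕ),
    (L.map f).bdry ε n = (L.bdry ε n).map f
  | pt _, _ => rfl
  | cons t L R, 0 => by
      rw [bdry_zero, bdry_zero, map, first_map, last_map]
      cases ε <;> rfl
  | cons t L R, n + 1 => by simp only [map, bdry, bdry_map f ε]

end LTree

/-! ### Boundary inclusions -/

theorem Tree.dim_disc : ∀ n : ℕ, (Tree.disc n).dim = n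
  | 0 => rfl
  | n + 1 => by simp [Tree.disc, Tree.dim, dim_disc n]

theorem Tree.dim_bdry_le : ∀ (T : Tree) (n : ℕ), (T.bdry n).dim ≤ n
  | .nil, n => by simp [Tree.bdry, Tree.dim]
  | .cons _ _, 0 => by simp [Tree.bdry, Tree.dim]
  | .cons T Ts, n + 1 => by
      simp only [Tree.bdry, Tree.dim, max_le_iff, Nat.add_le_add_iff_right]
      exact ⟨T.dim_bdry_le n, Ts.dim_bdry_le (n + 1)⟩

theorem Tree.dim_bdry_le_dim : ∀ (T : Tree) (n : ℕ), (T.bdry n).dim ≤ T.dim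
  | .nil, n => by simp [Tree.bdry, Tree.dim]
  | .cons _ _, 0 => by simp [Tree.bdry, Tree.dim]
  | .cons T Ts, n + 1 => by
      have := T.dim_bdry_le_dim n
      have := Ts.dim_bdry_le_dim (n + 1)
      simp only [Tree.bdry, Tree.dim]
      omega

theorem Tree.dim_bdry_eq : ∀ (T : Tree) {n : ℕ}, n ≤ T.dim → (T.bdry n).dim = n
  | .nil, n, h => by simp only [Tree.bdry, Tree.dim] at *; omega
  | .cons _ _, 0, _ => by simp [Tree.bdry, Tree.dim]
  | .cons T Ts, n + 1, h => by
      have h1 := T.dim_bdry_le n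
      have h2 := Ts.dim_bdry_le (n + 1)
      simp only [Tree.bdry, Tree.dim] at *
      rcases le_max_iff.mp h with h | h
      · have := T.dim_bdry_eq (Nat.le_of_succ_le_succ h); omega
      · have := Ts.dim_bdry_eq h; omega

theorem Tree.bdry_eq_self : ∀ (T : Tree) {n : ℕ}, T.dim ≤ n → T.bdry n = T
  | .nil, _, _ => by rw [Tree.bdry]
  | .cons T Ts, 0, h => by simp [Tree.dim] at h
  | .cons T Ts, n + 1, h => by
      simp only [Tree.dim, max_le_iff, Nat.add_le_add_iff_right] at h
      rw [Tree.bdry, T.bdry_eq_self h.1, Ts.bdry_eq_self h.2]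

theorem Tree.lookup_lastPt : ∀ T : Tree, T.ctx.lookup T.lastPt = .star
  | .nil => Tree.lookup_zero .nil
  | .cons T Ts => by
      rw [Tree.lastPt]
      refine (Tree.lookup_cons_wr T Ts _).trans ?_
      rw [Tree.lookup_lastPt Ts]; rfl

theorem Sub.wedge_wl {n m n' m' : ℕ} (σ : Sub (n + 1) (n' + 1)) (p : Fin (n' + 1))
    (τ : Sub (m + 1) (m' + 1)) (i : Fin (n + 1)) :
    Sub.wedge σ p τ (wl i) = (σ i).sub (Sub.ren wl) :=
  wedgeElim_wl _ _ _

theorem Sub.wedge_wr {n m n' m' : ℕ} (σ : Sub (n + 1) (n' + 1)) (p : Fin (n' + 1))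
    (τ : Sub (m + 1) (m' + 1)) (q : Fin (n + 1)) (hσ : σ q = .var p) (hτ : τ 0 = .var 0)
    (i : Fin (m + 1)) : Sub.wedge σ p τ (wr q i) = (τ i).sub (Sub.ren (wr p)) :=
  wedgeElim_wr _ _ _ (by simp only [Sub.comp, hσ, hτ]; rfl) _

theorem Tree.incl_succ_zero (ε : Bool) (T : Tree) (n : ℕ) : T.incl ε (n + 1) 0 = .var 0 := by
  cases T with
  | nil => rw [Tree.incl]; rfl
  | cons T Ts => rw [Tree.incl]; exact Sub.wedge_wl _ _ _ 0

theorem Tree.incl_cons_zero (ε : Bool) (T Ts : Tree) (n : ℕ) :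
    (Tree.cons T Ts).incl ε (n + 1) (wl 0) = .var (wl 0) := Tree.incl_succ_zero _ _ _

theorem Tree.incl_cons_wl (ε : Bool) (T Ts : Tree) (n : ℕ) (i : Fin ((T.bdry n).len + 1)) :
    (Tree.cons T Ts).incl ε (n + 1) (wl i.succ.succ) =
      (T.incl ε n i).susp.sub (Sub.ren wl) := by
  rw [Tree.incl]
  exact Sub.wedge_wl _ _ _ i.succ.succ

theorem Tree.incl_cons_wr (ε : Bool) (T Ts : Tree) (n : ℕ)
    (i : Fin ((Ts.bdry (n + 1)).len + 1)) :
    (Tree.cons T Ts).incl ε (n + 1) (wr 1 i) =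
      (Ts.incl ε (n + 1) i).sub (Sub.ren (wr 1)) := by
  rw [Tree.incl]
  exact Sub.wedge_wr (T.incl ε n).susp 1 _ 1 rfl (Tree.incl_succ_zero _ _ _) _

/-- The boundary inclusions are renamings that preserve the types of variables. -/
theorem Tree.incl_eq_ren (ε : Bool) : ∀ (T : Tree) (n : ℕ),
    ∃ f : Fin ((T.bdry n).len + 1) → Fin (T.len + 1), (∀ i, T.incl ε n i = .var (f i)) ∧
      ∀ i, T.ctx.lookup (f i) = ((T.bdry n).ctx.lookup i).sub (Sub.ren f)
  | .nil, n => by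
      refine ⟨fun i => i, fun i => by rw [Tree.incl]; rfl, fun i => ?_⟩
      exact (Ty.sub_ident _).symm
  | .cons T Ts, 0 => by
      refine ⟨fun _ => if ε then (Tree.cons T Ts).lastPt else 0, fun i => by rw [Tree.incl],
        fun i => ?_⟩
      have hi : (((Tree.cons T Ts).bdry 0).ctx.lookup i) = .star := by
        rw [Subsingleton.elim (α := Fin 1) i (0 : Fin 1)]
        exact Tree.lookup_zero .nil
      rw [hi]
      cases ε
      · exact Tree.lookup_zero _
      · exact Tree.lookup_lastPt _
  | .cons T Ts, n + 1 => by
      obtain ⟨f, hf, hf'⟩ := Tree.incl_eq_ren ε T n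
      obtain ⟨g, hg, hg'⟩ := Tree.incl_eq_ren ε Ts (n + 1)
      have hg0 : g 0 = 0 := by
        injection (hg 0).symm.trans (Tree.incl_succ_zero ε Ts n)
      let F : Fin ((Tree.cons (T.bdry n) (Ts.bdry (n + 1))).len + 1) →
          Fin ((Tree.cons T Ts).len + 1) :=
        wedgeElim (fun i => wl (suspRen f i)) (fun i => wr 1 (g i))
      have F0 : F (wl 0) = wl 0 := wedgeElim_wl _ _ _
      have Fl : ∀ i, F (wl i.succ.succ) = wl (f i).succ.succ := fun i => wedgeElim_wl _ _ _
      have Fr : ∀ i, F (wr 1 i) = wr 1 (g i) := fun i =>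
        wedgeElim_wr _ _ _ (by rw [hg0]; rfl) i
      refine ⟨F, fun i => ?_, fun i => ?_⟩
      · induction i using Tree.consCases with
        | h0 => exact (Tree.incl_cons_zero ε T Ts n).trans (congrArg Tm.var F0).symm
        | hl i =>
          refine (Tree.incl_cons_wl ε T Ts n i).trans ?_
          rw [hf, Tm.susp]
          exact (congrArg Tm.var (Fl i)).symm
        | hr i =>
          refine (Tree.incl_cons_wr ε T Ts n i).trans ?_
          rw [hg]
          exact (congrArg Tm.var (Fr i)).symm
      · induction i using Tree.consCases with
        | h0 =>
          refine (congrArg _ F0).trans ((Tree.lookup_cons_zero T Ts).trans ?_)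
          exact (congrArg (Ty.sub · (Sub.ren F))
            (Tree.lookup_cons_zero (T.bdry n) (Ts.bdry (n + 1)))).symm
        | hl i =>
          refine (congrArg _ (Fl i)).trans ((Tree.lookup_cons_wl T Ts (f i)).trans ?_)
          refine Eq.trans ?_ (congrArg (Ty.sub · (Sub.ren F))
            (Tree.lookup_cons_wl (T.bdry n) (Ts.bdry (n + 1)) i)).symm
          refine Eq.trans ?_ (Ty.sub_sub _ _ _).symm
          rw [hf', Ty.susp_sub, Sub.susp_ren, Ty.sub_sub]
          refine congrArg (Ty.sub _) ?_
          funext j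
          exact congrArg Tm.var
            (wedgeElim_wl (fun i => wl (suspRen f i)) (fun i => wr 1 (g i)) j).symm
        | hr i =>
          refine (congrArg _ (Fr i)).trans ((Tree.lookup_cons_wr T Ts (g i)).trans ?_)
          refine Eq.trans ?_ (congrArg (Ty.sub · (Sub.ren F))
            (Tree.lookup_cons_wr (T.bdry n) (Ts.bdry (n + 1)) i)).symm
          refine Eq.trans ?_ (Ty.sub_sub _ _ _).symm
          rw [hg', Ty.sub_sub]
          refine congrArg (Ty.sub _) ?_
          funext j
          exact congrArg Tm.var (Fr j).symm

/-- The boundary inclusion in a dimension at least that of the tree is surjective on variables. -/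
theorem Tree.exists_incl_eq_var (ε : Bool) : ∀ (T : Tree) {n : ℕ}, T.dim ≤ n →
    ∀ i, ∃ j, T.incl ε n j = .var i
  | .nil, _, _, i => ⟨i, by rw [Tree.incl]; rfl⟩
  | .cons T Ts, 0, h, _ => by simp [Tree.dim] at h
  | .cons T Ts, n + 1, h, i => by
      simp only [Tree.dim, max_le_iff, Nat.add_le_add_iff_right] at h
      induction i using Tree.consCases with
      | h0 => exact ⟨wl 0, Tree.incl_cons_zero ε T Ts n⟩
      | hl i =>
        obtain ⟨j, hj⟩ := Tree.exists_incl_eq_var ε T h.1 i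
        refine ⟨wl j.succ.succ, (Tree.incl_cons_wl ε T Ts n j).trans ?_⟩
        rw [hj]; rfl
      | hr i =>
        obtain ⟨j, hj⟩ := Tree.exists_incl_eq_var ε Ts h.2 i
        refine ⟨wr 1 j, (Tree.incl_cons_wr ε T Ts n j).trans ?_⟩
        rw [hj]; rfl

namespace LTree

variable {k : ℕ}

theorem last_of : ∀ (T : Tree) (σ : Sub (T.len + 1) k), (of T σ).last = σ T.lastPt
  | .nil, _ => rfl
  | .cons _ Ts, _ => last_of Ts _

/-- Restriction along a boundary inclusion is truncation of the labelled tree. -/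
theorem of_bdry (ε : Bool) : ∀ (T : Tree) (n : ℕ) (σ : Sub (T.len + 1) k),
    of (T.bdry n) ((T.incl ε n).comp σ) = (of T σ).bdry ε n
  | .nil, n, σ => by rw [Tree.incl]; rfl
  | .cons T Ts, 0, σ => by
      rw [bdry_zero, last_of, first_of, Tree.incl]
      change pt _ = pt _
      cases ε <;> rfl
  | .cons T Ts, n + 1, σ => by
      rw [of, bdry, ← of_bdry ε T n, ← of_bdry ε Ts (n + 1)]
      obtain ⟨f, hf, -⟩ := Tree.incl_eq_ren ε T n
      change cons (((Tree.cons T Ts).incl ε (n + 1) (wl 0)).sub σ)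
        (of _ fun i => ((Tree.cons T Ts).incl ε (n + 1) (wl i.succ.succ)).sub σ)
        (of _ fun i => ((Tree.cons T Ts).incl ε (n + 1) (wr 1 i)).sub σ) = _
      congr 1
      · congr 1
        funext i
        refine (congrArg (Tm.sub · σ) (Tree.incl_cons_wl ε T Ts n i)).trans ?_
        simp only [Sub.comp, hf]
        rfl
      · congr 1
        funext i
        refine (congrArg (Tm.sub · σ) (Tree.incl_cons_wr ε T Ts n i)).trans ?_
        exact Tm.sub_sub _ _ _

end LTree

/-! ### Replacing the base type -/

/-- Substitution into a type together with the replacement of `⋆` by `A`. -/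
def Ty.subOver {m k : ℕ} : Ty m → Ty k → Sub m k → Ty k
  | .star, A, _ => A
  | .arr s B t, A, σ => .arr (s.sub σ) (B.subOver A σ) (t.sub σ)

theorem Ty.subOver_star {m k : ℕ} (σ : Sub m k) : ∀ B : Ty m, B.subOver .star σ = B.sub σ
  | .star => rfl
  | .arr s B t => by rw [Ty.subOver, Ty.sub, subOver_star σ B]

theorem Ty.subOver_sub {l m k : ℕ} (A : Ty k) (ρ : Sub l m) (σ : Sub m k) :
    ∀ B : Ty l, (B.sub ρ).subOver A σ = B.subOver A (ρ.comp σ)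
  | .star => rfl
  | .arr s B t => by
      rw [Ty.sub, Ty.subOver, Ty.subOver, subOver_sub A ρ σ B, Tm.sub_sub, Tm.sub_sub]

theorem Ty.subOver_susp {m k : ℕ} {Δ : Ctx m} (A : Ty k) (σ : Sub (m + 2) k) {B : Ty m}
    (hB : Δ.Glob B) :
    B.susp.subOver A σ = B.subOver (.arr (σ 0) A (σ 1)) (fun i => σ i.succ.succ) := by
  induction hB with
  | star => rw [Ty.susp]; rfl
  | arr x y _ _ _ ih =>
    rw [Ty.susp, Ty.subOver, Ty.subOver, ih, Tm.susp, Tm.susp]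
    rfl

namespace LTree

variable {k : ℕ}

/-! ### Unbiased expressions over labelled trees -/

/-- The unbiased type over the underlying tree, under the labelling. -/
def uty (n : ℕ) (L : LTree k) : Ty k := (unbTy n L.shape).sub L.toSub

/-- The unbiased term over the underlying tree, under the labelling. -/
def utm (n : ℕ) (L : LTree k) : Tm k := (unbTm n L.shape).sub L.toSub

/-- The unbiased coherence over the underlying tree, under the labelling. -/
def ucoh (n : ℕ) (L : LTree k) : Tm k := .coh L.shape.ctx (unbTy n L.shape) L.toSub

/-- The label that is reached by following the first subtrees. For a linear tree it is the label
of the top variable. -/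
def leaf : LTree k → Tm k
  | pt t => t
  | cons _ L _ => L.leaf

theorem apply_of {X : Type} (F : (T : Tree) → Sub (T.len + 1) k → X) (T : Tree)
    (σ : Sub (T.len + 1) k) : F (of T σ).shape (of T σ).toSub = F T σ :=
  congrArg (fun p : Σ T : Tree, Sub (T.len + 1) k => F p.1 p.2) (mk_shape_toSub_of T σ)

theorem uty_of (n : ℕ) (T : Tree) (σ : Sub (T.len + 1) k) :
    uty n (of T σ) = (unbTy n T).sub σ :=
  apply_of (fun T σ => (unbTy n T).sub σ) T σ

theorem utm_of (n : ℕ) (T : Tree) (σ : Sub (T.len + 1) k) :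
    utm n (of T σ) = (unbTm n T).sub σ :=
  apply_of (fun T σ => (unbTm n T).sub σ) T σ

theorem ucoh_of (n : ℕ) (T : Tree) (σ : Sub (T.len + 1) k) :
    ucoh n (of T σ) = .coh T.ctx (unbTy n T) σ :=
  apply_of (fun T σ => Tm.coh T.ctx (unbTy n T) σ) T σ

theorem unbCoh_sub (n : ℕ) (T : Tree) (σ : Sub (T.len + 1) k) :
    (unbCoh n T).sub σ = ucoh n (of T σ) := by
  rw [ucoh_of]; rfl

theorem utm_bdry (ε : Bool) (m n : ℕ) (L : LTree k) :
    utm m (L.bdry ε n) =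
      (unbTm m (L.shape.bdry n)).sub ((L.shape.incl ε n).comp L.toSub) := by
  conv_lhs => rw [← of_shape_toSub L]
  rw [← of_bdry, utm_of]

theorem uty_succ (n : ℕ) (L : LTree k) :
    uty (n + 1) L = .arr (utm n (L.bdry false n)) (uty n L) (utm n (L.bdry true n)) := by
  rw [utm_bdry, utm_bdry, uty, unbTy_succ, Ty.sub, Tm.sub_sub, Tm.sub_sub]
  rfl

/-- Unbiased types are globular: they depend only on the truncations in lower dimensions. -/
theorem uty_bdry (ε : Bool) (L : LTree k) : ∀ {m n : ℕ}, m ≤ n →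
    uty m (L.bdry ε n) = uty m L
  | 0, _, _ => rfl
  | m + 1, n, h => by
      rw [uty_succ, uty_succ, bdry_bdry _ _ _ h, bdry_bdry _ _ _ h,
        uty_bdry ε L (Nat.le_of_succ_le h)]

theorem toSub_last_of_disc : ∀ {n : ℕ} {L : LTree k}, L.shape = Tree.disc n →
    L.toSub (Fin.last _) = L.leaf
  | _, pt t, _ => rfl
  | 0, cons _ _ _, h => by simp [shape, Tree.disc] at h
  | n + 1, cons t L (cons _ _ _), h => by simp [shape, Tree.disc] at h
  | n + 1, cons t L (pt u), h => by
      simp only [shape, Tree.disc, Tree.cons.injEq, and_true] at h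
      exact (toSub_cons_wl t L (pt u) (Fin.last _)).trans (toSub_last_of_disc h)

theorem utm_of_disc {n : ℕ} {L : LTree k} (h : L.shape = Tree.disc n) : utm n L = L.leaf := by
  rw [utm, unbTm, if_pos h]
  exact toSub_last_of_disc h

theorem utm_of_not_disc {n : ℕ} {L : LTree k} (h : L.shape ≠ Tree.disc n) :
    utm n L = ucoh n L := by
  rw [utm, unbTm, if_neg h]
  rfl

theorem utm_zero_pt (t : Tm k) : utm 0 (pt t) = t := utm_of_disc rfl

/-- The substitution out of a suspension that is given by the images `t` and `u` of the two new
variables and by a substitution. -/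
def suspExt {m : ℕ} (t u : Tm k) (ρ : Sub m k) : Sub (m + 2) k :=
  Fin.cases (motive := fun _ => Tm k) t (Fin.cases (motive := fun _ => Tm k) u ρ)

theorem of_cons_nil_susp {l : ℕ} (t u : Tm l) (ρ : Sub k l) (X : LTree k) :
    of (.cons X.shape .nil) (X.toSub.susp.comp (suspExt t u ρ)) =
      cons t (X.map fun s => s.susp.sub (suspExt t u ρ)) (pt u) := by
  conv_rhs => rw [← of_shape_toSub X, of_map]
  rfl

/-- Unbiased terms commute with suspension, which adds a trunk of height one to the tree. -/
theorem utm_susp {l : ℕ} (t u : Tm l) (ρ : Sub k l) (n : ℕ) (X : LTree k) :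
    (utm n X).susp.sub (suspExt t u ρ) =
      utm (n + 1) (cons t (X.map fun s => s.susp.sub (suspExt t u ρ)) (pt u)) := by
  rw [← of_cons_nil_susp, utm, Tm.susp_sub, Tm.sub_sub, susp_unbTm]
  exact (utm_of (n + 1) (.cons X.shape .nil) _).symm

theorem ucoh_susp {l : ℕ} (t u : Tm l) (ρ : Sub k l) (n : ℕ) (X : LTree k) :
    (ucoh n X).susp.sub (suspExt t u ρ) =
      ucoh (n + 1) (cons t (X.map fun s => s.susp.sub (suspExt t u ρ)) (pt u)) := by
  rw [← of_cons_nil_susp]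
  refine Eq.trans ?_ (unbCoh_sub (n + 1) (.cons X.shape .nil) _)
  refine Eq.trans ?_ (congrArg (Tm.sub · _) (susp_unbCoh n X.shape))
  refine Eq.trans ?_ (Tm.sub_sub _ _ _)
  refine congrArg (Tm.sub · (suspExt t u ρ))
    (?_ : (ucoh n X).susp = (unbCoh n X.shape).susp.sub X.toSub.susp)
  rw [← Tm.susp_sub, unbCoh_sub, of_shape_toSub]

theorem utm_sub {l : ℕ} (ρ : Sub k l) (n : ℕ) (X : LTree k) :
    (utm n X).sub ρ = utm n (X.map fun s => s.sub ρ) := by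
  rw [map_sub, utm_of, utm, Tm.sub_sub]

theorem ucoh_sub {l : ℕ} (ρ : Sub k l) (n : ℕ) (X : LTree k) :
    (ucoh n X).sub ρ = ucoh n (X.map fun s => s.sub ρ) := by
  rw [map_sub, ucoh_of]
  rfl

/-! ### Trunks -/

/-- The labelled tree that has `T` on top of a trunk; the list contains the labels of the end
points of the trunk, the highest ones first. -/
def onTrunk : List (Tm k × Tm k) → LTree k → LTree k
  | [], T => T
  | p :: c, T => onTrunk c (cons p.1 T (pt p.2))

/-- The type given by the labels of a trunk. -/
def trunkTy : List (Tm k × Tm k) → Ty k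
  | [] => .star
  | p :: c => .arr p.1 (trunkTy c) p.2

theorem bdry_onTrunk (ε : Bool) : ∀ (c : List (Tm k × Tm k)) (T : LTree k) (n : ℕ),
    (onTrunk c T).bdry ε (c.length + n) = onTrunk c (T.bdry ε n)
  | [], T, n => by simp [onTrunk]
  | p :: c, T, n => by
      have := bdry_onTrunk ε c (cons p.1 T (pt p.2)) (n + 1)
      rw [onTrunk, onTrunk, List.length_cons, Nat.add_assoc, Nat.add_comm 1 n]
      exact this

theorem shape_onTrunk_disc : ∀ (c : List (Tm k × Tm k)) {T : LTree k} {n : ℕ},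
    T.shape = Tree.disc n → (onTrunk c T).shape = Tree.disc (c.length + n)
  | [], _, _, h => by simpa [onTrunk] using h
  | p :: c, T, n, h => by
      have := shape_onTrunk_disc c (T := cons p.1 T (pt p.2)) (n := n + 1)
        (by simp [shape, Tree.disc, h])
      rw [onTrunk, List.length_cons, Nat.add_assoc, Nat.add_comm 1 n]
      exact this

theorem leaf_onTrunk : ∀ (c : List (Tm k × Tm k)) (T : LTree k), (onTrunk c T).leaf = T.leaf
  | [], _ => rfl
  | p :: c, T => leaf_onTrunk c (cons p.1 T (pt p.2))

theorem dim_onTrunk : ∀ (c : List (Tm k × Tm k)) (T : LTree k),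
    (onTrunk c T).shape.dim = c.length + T.shape.dim
  | [], T => by simp [onTrunk]
  | p :: c, T => by
      rw [onTrunk, dim_onTrunk c]
      simp [shape, Tree.dim]
      omega

/-- The boundary at the height of the trunk is a disc, so its unbiased term is the label of its top
variable, an end point of the tree on top of the trunk. -/
theorem utm_bdry_onTrunk (ε : Bool) (c : List (Tm k × Tm k)) (T : LTree k) :
    utm c.length ((onTrunk c T).bdry ε c.length) = if ε then T.last else T.first := by
  have h := bdry_onTrunk ε c T 0
  rw [Nat.add_zero] at h
  rw [h, bdry_zero]
  exact (utm_of_disc (shape_onTrunk_disc c (n := 0) rfl)).trans (leaf_onTrunk _ _)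

theorem uty_onTrunk : ∀ (c : List (Tm k × Tm k)) (T : LTree k),
    uty c.length (onTrunk c T) = trunkTy c
  | [], _ => rfl
  | p :: c, T => by
      rw [List.length_cons, onTrunk, uty_succ, utm_bdry_onTrunk, utm_bdry_onTrunk, uty_onTrunk c]
      rfl

/-! ### Typed labelled trees -/

/-- The labels of a labelled tree are terms over `Γ` of the types required, where the labels in
dimension zero are of type `A`. -/
def Typed (R : RuleSet) (Γ : Ctx k) : Ty k → LTree k → Prop
  | A, pt t => WfTm R Γ t A
  | A, cons t L M => WfTm R Γ t A ∧ L.Typed R Γ (.arr t A M.first) ∧ M.Typed R Γ A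

/-- A labelling is typed over the base type `A` iff the labels have the types of the variables with
`⋆` replaced by `A`. The base type accounts for suspensions. -/
theorem typed_of_iff {Γ : Ctx k} : ∀ {T : Tree} {A : Ty k} {σ : Sub (T.len + 1) k},
    (of T σ).Typed R Γ A ↔ ∀ x, WfTm R Γ (σ x) ((T.ctx.lookup x).subOver A σ)
  | .nil, A, σ => by
      have h0 : Tree.nil.ctx.lookup 0 = .star := Tree.lookup_zero .nil
      constructor
      · intro h x
        obtain rfl : x = 0 := Subsingleton.elim (α := Fin 1) x 0
        rw [h0]
        exact h
      · intro h
        have := h 0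
        rw [h0] at this
        exact this
  | .cons T Ts, A, σ => by
      have e0 : ((Tree.cons T Ts).ctx.lookup (wl 0)).subOver A σ = A := by
        rw [Tree.lookup_cons_zero]; rfl
      have el : ∀ i, ((Tree.cons T Ts).ctx.lookup (wl i.succ.succ)).subOver A σ =
          (T.ctx.lookup i).subOver (.arr (σ 0) A (σ (wl 1))) (fun i => σ (wl i.succ.succ)) := by
        intro i
        rw [Tree.lookup_cons_wl]
        refine (Ty.subOver_sub _ _ _ _).trans ?_
        rw [Ty.subOver_susp A _ (T.glob_lookup i)]
        rfl
      have er : ∀ i, ((Tree.cons T Ts).ctx.lookup (wr 1 i)).subOver A σ =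
          (Ts.ctx.lookup i).subOver A (fun i => σ (wr 1 i)) := by
        intro i
        rw [Tree.lookup_cons_wr]
        exact Ty.subOver_sub _ _ _ _
      rw [of, Typed, first_of, typed_of_iff, typed_of_iff, wr_zero]
      constructor
      · rintro ⟨h0, hl, hr⟩ x
        induction x using Tree.consCases with
        | h0 => exact e0.symm ▸ h0
        | hl i => exact (el i).symm ▸ hl i
        | hr i => exact (er i).symm ▸ hr i
      · intro h
        exact ⟨e0 ▸ h (wl 0), fun i => el i ▸ h _, fun i => er i ▸ h _⟩

theorem Typed.wfSub {Γ : Ctx k} {L : LTree k} (h : L.Typed R Γ .star) :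
    WfSub R Γ L.shape.ctx L.toSub := by
  refine WfSub.of_lookup (Tree.wfCtx _) fun x => ?_
  rw [← of_shape_toSub L, typed_of_iff] at h
  rw [← Ty.subOver_star]
  exact h x

theorem typed_ident (T : Tree) : (of T (Sub.ident _)).Typed R T.ctx .star := by
  rw [typed_of_iff]
  intro x
  rw [Ty.subOver_star, Ty.sub_ident]
  exact .var x T.wfCtx

theorem Typed.first {Γ : Ctx k} {A : Ty k} {L : LTree k} (h : L.Typed R Γ A) :
    WfTm R Γ L.first A := by
  cases L with
  | pt t => exact h
  | cons t L M => exact h.1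

theorem Typed.last {Γ : Ctx k} {A : Ty k} : ∀ {L : LTree k}, L.Typed R Γ A →
    WfTm R Γ L.last A
  | pt _, h => h
  | cons _ _ M, h => Typed.last (L := M) h.2.2

theorem Typed.bdry {Γ : Ctx k} (ε : Bool) : ∀ {L : LTree k} {A : Ty k} (n : ℕ),
    L.Typed R Γ A → (L.bdry ε n).Typed R Γ A
  | pt _, _, _, h => h
  | cons t L M, A, 0, h => by
      rw [bdry_zero]
      cases ε
      · exact h.first
      · exact h.last
  | cons t L M, A, n + 1, h => by
      refine ⟨h.1, ?_, h.2.2.bdry ε (n + 1)⟩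
      rw [first_bdry_succ]
      exact h.2.1.bdry ε n

theorem typed_append_iff {Γ : Ctx k} {A : Ty k} {M : LTree k} : ∀ {L : LTree k},
    M.first = L.last →
      ((L.append M).Typed R Γ A ↔ L.Typed R Γ A ∧ M.Typed R Γ A)
  | pt t, h => by
      rw [append, show t = M.first from h.symm, setFirst_first]
      exact ⟨fun h => ⟨h.first, h⟩, fun h => h.2⟩
  | cons t L L', h => by
      rw [append, Typed, Typed, typed_append_iff (L := L') h, first_append]
      tauto

/-- The top label of a disc on a trunk has the unbiased type. -/
theorem Typed.leaf_of_disc {Γ : Ctx k} : ∀ {m : ℕ} {T : LTree k} {c : List (Tm k × Tm k)},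
    T.Typed R Γ (trunkTy c) → T.shape = Tree.disc m →
      WfTm R Γ T.leaf (uty (c.length + m) (onTrunk c T))
  | 0, pt t, c, h, _ => by
      rw [Nat.add_zero, uty_onTrunk]; exact h
  | n + 1, pt t, _, _, h => by simp [shape, Tree.disc] at h
  | 0, cons _ _ _, _, _, h => by simp [shape, Tree.disc] at h
  | n + 1, cons t L (cons _ _ _), _, _, h => by simp [shape, Tree.disc] at h
  | n + 1, cons t L (pt u), c, h, hs => by
      simp only [shape, Tree.disc, Tree.cons.injEq, and_true] at hs
      have := Typed.leaf_of_disc (c := (t, u) :: c) h.2.1 hs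
      rw [List.length_cons, Nat.add_assoc, Nat.add_comm 1 n] at this
      exact this

end LTree

/-! ### Supports of unbiased terms -/

theorem Ctx.subset_downClosure {n : ℕ} (Γ : Ctx n) (X : Set (Fin n)) :
    X ⊆ Γ.downClosure X := fun _ hx _ hY => hY.1 hx

theorem Ctx.downClosed_downClosure {n : ℕ} (Γ : Ctx n) (X : Set (Fin n)) :
    Γ.DownClosed (Γ.downClosure X) :=
  fun x hx _ hy Y hY => hY.2 x (hx Y hY) hy

theorem Ctx.downClosure_subset {n : ℕ} {Γ : Ctx n} {X Y : Set (Fin n)} (h : X ⊆ Y)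
    (hY : Γ.DownClosed Y) : Γ.downClosure X ⊆ Y := fun _ hx => hx Y ⟨h, hY⟩

theorem Tm.fv_sub {m n : ℕ} (σ : Sub m n) : ∀ t : Tm m, (t.sub σ).fv = ⋃ x ∈ t.fv, (σ x).fv
  | .var x => by simp [Tm.sub, Tm.fv]
  | .coh Δ A τ => by
      simp only [Tm.sub, Tm.fv, Tm.fv_sub σ (τ _), Set.mem_iUnion]
      ext y
      simp only [Set.mem_iUnion]
      constructor
      · rintro ⟨i, x, hx, hy⟩; exact ⟨x, ⟨i, hx⟩, hy⟩
      · rintro ⟨x, ⟨i, hx⟩, hy⟩; exact ⟨i, x, hx, hy⟩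

theorem Ty.mem_fv_ren {m n : ℕ} (f : Fin m → Fin n) {x : Fin m} :
    ∀ A : Ty m, x ∈ A.fv → f x ∈ (A.sub (Sub.ren f)).fv
  | .star, h => h
  | .arr s A t, h => by
      have hm : ∀ t : Tm m, x ∈ t.fv → f x ∈ (t.sub (Sub.ren f)).fv := fun t ht => by
        rw [Tm.fv_sub]
        exact Set.mem_biUnion ht rfl
      rcases h with (h | h) | h
      · exact .inl (.inl (hm _ h))
      · exact .inl (.inr (Ty.mem_fv_ren f A h))
      · exact .inr (hm _ h)

theorem Ty.fv_susp_of_glob {n : ℕ} {Γ : Ctx n} {A : Ty n} (h : Γ.Glob A) :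
    {0, 1} ⊆ A.susp.fv ∧ ∀ x ∈ A.fv, x.succ.succ ∈ A.susp.fv := by
  induction h with
  | star => rw [Ty.susp]; simp [Ty.fv, Tm.fv, Set.pair_subset_iff]
  | arr x y _ _ _ ih =>
    rw [Ty.susp, Tm.susp, Tm.susp]
    simp only [Ty.fv, Tm.fv]
    refine ⟨fun z hz => .inl (.inr (ih.1 hz)), ?_⟩
    rintro z ((rfl | hz) | rfl)
    · exact .inl (.inl rfl)
    · exact .inl (.inr (ih.2 z hz))
    · exact .inr rfl

/-- A downward closed set of variables of a disc that contains the top variable contains all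
variables. -/
theorem Tree.disc_downClosed : ∀ (n : ℕ) {X : Set (Fin ((Tree.disc n).len + 1))},
    (Tree.disc n).ctx.DownClosed X → Fin.last _ ∈ X → ∀ x, x ∈ X
  | 0, X, _, h, x => by
      rw [Subsingleton.elim (α := Fin 1) x (0 : Fin 1)]; exact h
  | n + 1, X, hX, h, x => by
      have hX' : (Tree.disc n).ctx.susp.DownClosed X := by
        have e : (Tree.disc (n + 1)).ctx = (Tree.disc n).ctx.susp := Tree.ctx_cons_nil _
        rwa [e] at hX
      have hs : ∀ i : Fin ((Tree.disc n).len + 1), i.succ.succ ∈ X →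
          {0, 1} ⊆ X ∧ ∀ x ∈ ((Tree.disc n).ctx.lookup i).fv, x.succ.succ ∈ X := by
        intro i hi
        have := hX' _ hi
        rw [Ctx.lookup_susp_succ] at this
        have h' := Ty.fv_susp_of_glob ((Tree.disc n).glob_lookup i)
        exact ⟨h'.1.trans this, fun x hx => this (h'.2 x hx)⟩
      have hall := Tree.disc_downClosed n (X := {i | i.succ.succ ∈ X})
        (fun i hi x hx => (hs i hi).2 x hx) h
      have h01 := (hs (Fin.last _) h).1
      exact suspCases (p := fun x : Fin ((Tree.disc n).len + 1 + 2) => x ∈ X)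
        (h01 (Or.inl rfl)) (h01 (Or.inr rfl)) hall x

theorem Tree.downClosed_of_eq_disc {T : Tree} {n : ℕ} (hT : T = Tree.disc n)
    {X : Set (Fin (T.len + 1))} (hX : T.ctx.DownClosed X) (h : Fin.last _ ∈ X) (x) : x ∈ X := by
  subst hT
  exact Tree.disc_downClosed n hX h x

/-- The unbiased term over a boundary has the support of the whole boundary. If the boundary is a
disc, the term is its top variable, whose downward closure is the disc. -/
theorem supp_unbTm (ε : Bool) (n : ℕ) (T : Tree) :
    ((unbTm n (T.bdry n)).sub (T.incl ε n)).supp T.ctx = (T.incl ε n).supp T.ctx := by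
  by_cases h : T.bdry n = Tree.disc n
  · rw [unbTm, if_pos h]
    obtain ⟨f, hf, hf'⟩ := T.incl_eq_ren ε n
    apply Set.Subset.antisymm
    · refine Ctx.downClosure_subset ?_ (Ctx.downClosed_downClosure _ _)
      exact (Set.subset_iUnion (fun i => (T.incl ε n i).fv) (Fin.last _)).trans
        (Ctx.subset_downClosure _ _)
    · refine Ctx.downClosure_subset ?_ (Ctx.downClosed_downClosure _ _)
      set Y := Ctx.downClosure T.ctx ((Tm.var (Fin.last (T.bdry n).len)).sub (T.incl ε n)).fv
        with hY
      have hYc : T.ctx.DownClosed Y := Ctx.downClosed_downClosure _ _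
      have hX : (T.bdry n).ctx.DownClosed {i | f i ∈ Y} := by
        intro i hi x hx
        refine hYc _ hi ?_
        rw [hf']
        exact Ty.mem_fv_ren f _ hx
      have hl : f (Fin.last _) ∈ Y := by
        refine Ctx.subset_downClosure _ _ ?_
        simp only [Tm.sub, hf]
        rfl
      have hall : ∀ x, f x ∈ Y := Tree.downClosed_of_eq_disc h hX hl
      rintro y hy
      obtain ⟨i, hi⟩ := Set.mem_iUnion.mp hy
      rw [hf] at hi
      rw [show y = f i from hi]
      exact hall i
  · rw [unbTm, if_neg h]
    rfl

theorem supp_unbTm_of_dim_le (ε : Bool) {n : ℕ} {T : Tree} (h : T.dim ≤ n) :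
    ((unbTm n (T.bdry n)).sub (T.incl ε n)).supp T.ctx = Set.univ := by
  rw [supp_unbTm, Set.eq_univ_iff_forall]
  intro x
  obtain ⟨j, hj⟩ := T.exists_incl_eq_var ε h x
  refine Ctx.subset_downClosure _ _ (Set.mem_iUnion.mpr ⟨j, ?_⟩)
  rw [hj]
  rfl

/-! ### Validity of unbiased expressions -/

namespace LTree

variable {k : ℕ}

/-- The unbiased coherence is a composite if `n = dim L`, and has full source and target if
`n > dim L`. For `n = 0` it is not valid, because its type is not an arrow type. -/
theorem wfTm_ucoh_of_wfTy {Γ : Ctx k} {n : ℕ} {L : LTree k} (hn : 1 ≤ n)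
    (hT : WfTy R L.shape.ctx (unbTy n L.shape)) (hL : L.Typed R Γ .star)
    (hd : L.shape.dim ≤ n) : WfTm R Γ (ucoh n L) (uty n L) := by
  obtain ⟨n, rfl⟩ := Nat.exists_eq_add_of_le' hn
  rw [ucoh, uty]
  rw [unbTy_succ] at hT ⊢
  rcases Nat.lt_or_ge n L.shape.dim with h | h
  · exact .comp n (by omega) hT hL.wfSub (supp_unbTm _ _ _) (supp_unbTm _ _ _)
  · exact .coh hT hL.wfSub (supp_unbTm_of_dim_le _ h) (supp_unbTm_of_dim_le _ h)

/-- Unbiased types and terms are valid. The term over a tree has the unbiased type, whose source and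
target are terms of lower dimension over the boundaries, so both claims go by one induction. -/
theorem wfTy_wfTm_unb : ∀ n : ℕ, (∀ T : Tree, WfTy R T.ctx (unbTy n T)) ∧
    ∀ {k : ℕ} {Γ : Ctx k} {L : LTree k}, L.Typed R Γ .star → L.shape.dim ≤ n →
      WfTm R Γ (utm n L) (uty n L) := by
  have step : ∀ n : ℕ, (∀ T : Tree, WfTy R T.ctx (unbTy n T)) →
      ∀ {k : ℕ} {Γ : Ctx k} {L : LTree k}, L.Typed R Γ .star → L.shape.dim ≤ n →
        WfTm R Γ (utm n L) (uty n L) := by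
    intro n hT k Γ L hL hd
    by_cases h : L.shape = Tree.disc n
    · rw [utm_of_disc h]
      have := Typed.leaf_of_disc (c := []) hL h
      rwa [List.length_nil, Nat.zero_add] at this
    · rw [utm_of_not_disc h]
      refine wfTm_ucoh_of_wfTy ?_ (hT _) hL hd
      by_contra h0
      obtain rfl : n = 0 := by omega
      apply h
      cases L with
      | pt t => rfl
      | cons t L M => simp [shape, Tree.dim] at hd
  intro n
  induction n with
  | zero =>
    have h0 : ∀ T : Tree, WfTy R T.ctx (unbTy 0 T) := fun T => .star
    exact ⟨h0, step 0 h0⟩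
  | succ n ih =>
    have h1 : ∀ T : Tree, WfTy R T.ctx (unbTy (n + 1) T) := by
      intro T
      have e : unbTy (n + 1) T = uty (n + 1) (of T (Sub.ident _)) := by
        rw [uty_of, Ty.sub_ident]
      have e' : unbTy n T = uty n (of T (Sub.ident _)) := by
        rw [uty_of, Ty.sub_ident]
      have hb : ∀ ε, WfTm R T.ctx (utm n ((of T (Sub.ident _)).bdry ε n))
          (uty n (of T (Sub.ident _))) := by
        intro ε
        have := ih.2 ((typed_ident (R := R) T).bdry ε n)
          (by rw [shape_bdry]; exact Tree.dim_bdry_le _ _)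
        rwa [uty_bdry _ _ le_rfl] at this
      rw [e, uty_succ]
      exact .arr (e' ▸ ih.1 T) (hb false) (hb true)
    exact ⟨h1, step _ h1⟩

theorem wfTy_unbTy (n : ℕ) (T : Tree) : WfTy R T.ctx (unbTy n T) := (wfTy_wfTm_unb n).1 T

theorem Typed.utm {Γ : Ctx k} {L : LTree k} (hL : L.Typed R Γ .star) {n : ℕ}
    (hd : L.shape.dim ≤ n) : WfTm R Γ (utm n L) (uty n L) := (wfTy_wfTm_unb n).2 hL hd

theorem Typed.ucoh {Γ : Ctx k} {L : LTree k} (hL : L.Typed R Γ .star) {n : ℕ} (hn : 1 ≤ n)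
    (hd : L.shape.dim ≤ n) : WfTm R Γ (ucoh n L) (uty n L) :=
  wfTm_ucoh_of_wfTy hn (wfTy_unbTy _ _) hL hd

end LTree

/-! ### Definitional equality of labelled trees -/

mutual

theorem EqTm.refl : ∀ {n : ℕ} {Γ : Ctx n} (t : Tm n), EqTm R Γ t t
  | _, _, .var x => .var x
  | _, _, .coh _ A σ => .coh (EqTy.refl A) fun i => EqTm.refl (σ i)

theorem EqTy.refl : ∀ {n : ℕ} {Γ : Ctx n} (A : Ty n), EqTy R Γ A A
  | _, _, .star => .star
  | _, _, .arr s A t => .arr (EqTm.refl s) (EqTm.refl t) (EqTy.refl A)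

end

namespace LTree

variable {k : ℕ}

/-- Labelled trees with the same underlying tree and definitionally equal labels. -/
inductive Eqv (R : RuleSet) (Γ : Ctx k) : LTree k → LTree k → Prop
  | pt {s t : Tm k} : EqTm R Γ s t → Eqv R Γ (pt s) (pt t)
  | cons {s t : Tm k} {L L' M M' : LTree k} : EqTm R Γ s t → Eqv R Γ L L' → Eqv R Γ M M' →
      Eqv R Γ (cons s L M) (cons t L' M')

theorem Eqv.refl {Γ : Ctx k} : ∀ L : LTree k, Eqv R Γ L L
  | LTree.pt t => .pt (EqTm.refl t)
  | LTree.cons t L M => .cons (EqTm.refl t) (Eqv.refl L) (Eqv.refl M)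

theorem Eqv.symm {Γ : Ctx k} {L L' : LTree k} (h : Eqv R Γ L L') : Eqv R Γ L' L := by
  induction h with
  | pt h => exact .pt h.symm
  | cons h _ _ ih1 ih2 => exact .cons h.symm ih1 ih2

theorem Eqv.shape_eq {Γ : Ctx k} {L L' : LTree k} (h : Eqv R Γ L L') : L.shape = L'.shape := by
  induction h with
  | pt h => rfl
  | cons h _ _ ih1 ih2 => rw [shape, shape, ih1, ih2]

theorem Eqv.leaf {Γ : Ctx k} {L L' : LTree k} (h : Eqv R Γ L L') :
    EqTm R Γ L.leaf L'.leaf := by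
  induction h with
  | pt h => exact h
  | cons h _ _ ih1 ih2 => exact ih1

/-- Labelwise equal trees have the same shape, and their substitutions are equal. -/
theorem Eqv.exists_sub {Γ : Ctx k} {L L' : LTree k} (h : Eqv R Γ L L') :
    ∃ σ, of L.shape σ = L' ∧ ∀ i, EqTm R Γ (L.toSub i) (σ i) := by
  induction h with
  | @pt s t h => exact ⟨fun _ => t, rfl, fun _ => h⟩
  | @cons s t L L' M M' h _ _ ih1 ih2 =>
    obtain ⟨σ, hσ, hσ'⟩ := ih1
    obtain ⟨τ, hτ, hτ'⟩ := ih2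
    let ρ : Sub ((LTree.cons s L M).shape.len + 1) k :=
      wedgeElim (suspExt t (τ 0) σ) τ
    have e0 : ρ (wl 0) = t := wedgeElim_wl _ _ _
    have el : ∀ i, ρ (wl i.succ.succ) = σ i := fun i => wedgeElim_wl _ _ _
    have er : ∀ i, ρ (wr 1 i) = τ i := fun i =>
      wedgeElim_wr (suspExt t (τ 0) σ) τ 1 rfl i
    refine ⟨ρ, ?_, fun i => ?_⟩
    · change LTree.cons (ρ (wl 0)) (of _ fun i => ρ (wl i.succ.succ)) (of _ fun i => ρ (wr 1 i)) = _
      simp only [e0, el, er]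
      rw [hσ, hτ]
    · induction i using Tree.consCases with
      | h0 => rw [e0]; exact (toSub_cons_zero s L M).symm ▸ h
      | hl i => rw [el]; exact (toSub_cons_wl s L M i).symm ▸ hσ' i
      | hr i => rw [er]; exact (toSub_cons_wr s L M i).symm ▸ hτ' i

theorem Eqv.ucoh {Γ : Ctx k} {L L' : LTree k} (h : Eqv R Γ L L') (n : ℕ) :
    EqTm R Γ (ucoh n L) (ucoh n L') := by
  obtain ⟨σ, rfl, hσ⟩ := h.exists_sub
  rw [ucoh_of]
  exact .coh (EqTy.refl _) hσ

theorem Eqv.utm {Γ : Ctx k} {L L' : LTree k} (h : Eqv R Γ L L') (n : ℕ) :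
    EqTm R Γ (utm n L) (utm n L') := by
  by_cases hd : L.shape = Tree.disc n
  · rw [utm_of_disc hd, utm_of_disc (h.shape_eq ▸ hd)]
    exact h.leaf
  · rw [utm_of_not_disc hd, utm_of_not_disc (h.shape_eq ▸ hd)]
    exact h.ucoh n

/-- Disc removal: the unbiased coherence agrees with the unbiased term. -/
theorem eqTm_ucoh_utm {Γ : Ctx k} {L : LTree k} {n : ℕ} (hL : L.Typed sua Γ .star)
    (hn : 1 ≤ n) (hd : L.shape.dim ≤ n) : EqTm sua Γ (ucoh n L) (utm n L) := by
  by_cases h : L.shape = Tree.disc n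
  · have key : ∀ (T : Tree) (σ : Sub (T.len + 1) k), T = Tree.disc n →
        sua Γ (ucoh n (of T σ)) (σ (Fin.last _)) := by
      rintro T σ rfl
      rw [← unbCoh_sub]
      exact .discRemoval Γ n σ
    have h' := key _ L.toSub h
    rw [of_shape_toSub, toSub_last_of_disc h] at h'
    rw [utm_of_disc h]
    exact .rule h' (hL.ucoh hn hd)
  · rw [utm_of_not_disc h]
    exact EqTm.refl _

/-! ### Discs labelled by unbiased types -/

/-- The part from dimension `b` to dimension `b + m` of the labelled disc given by the unbiased
type over `W` of dimension `b + m` and by the term `top`. -/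
def unbDisc (W : LTree k) (top : Tm k) : ℕ → ℕ → LTree k
  | _, 0 => pt top
  | b, m + 1 =>
      cons (utm b (W.bdry false b)) (unbDisc W top (b + 1) m) (pt (utm b (W.bdry true b)))

@[simp] theorem shape_unbDisc (W : LTree k) (top : Tm k) : ∀ b m : ℕ,
    (unbDisc W top b m).shape = Tree.disc m
  | _, 0 => rfl
  | b, m + 1 => by rw [unbDisc, shape, shape_unbDisc W top (b + 1) m]; rfl

@[simp] theorem leaf_unbDisc (W : LTree k) (top : Tm k) : ∀ b m : ℕ,
    (unbDisc W top b m).leaf = top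
  | _, 0 => rfl
  | b, m + 1 => leaf_unbDisc W top (b + 1) m

theorem wfTm_utm_bdry {Γ : Ctx k} {W : LTree k} (hW : W.Typed R Γ .star) (ε : Bool) (b : ℕ) :
    WfTm R Γ (utm b (W.bdry ε b)) (uty b W) := by
  rw [← uty_bdry ε W le_rfl]
  refine (hW.bdry ε b).utm ?_
  rw [shape_bdry]
  exact Tree.dim_bdry_le _ _

theorem typed_unbDisc {Γ : Ctx k} {W : LTree k} (hW : W.Typed R Γ .star) {top : Tm k} :
    ∀ (b m : ℕ), WfTm R Γ top (uty (b + m) W) → (unbDisc W top b m).Typed R Γ (uty b W)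
  | _, 0, h => h
  | b, m + 1, h => by
      refine ⟨wfTm_utm_bdry hW _ _, ?_, wfTm_utm_bdry hW _ _⟩
      have := typed_unbDisc hW (b + 1) m (by rwa [Nat.add_assoc, Nat.add_comm 1 m])
      rwa [uty_succ] at this

theorem eqv_unbDisc {Γ : Ctx k} (W : LTree k) {s t : Tm k} (h : EqTm R Γ s t) : ∀ b m : ℕ,
    Eqv R Γ (unbDisc W s b m) (unbDisc W t b m)
  | _, 0 => .pt h
  | b, m + 1 => .cons (EqTm.refl _) (eqv_unbDisc W h (b + 1) m) (.pt (EqTm.refl _))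

theorem bdry_unbDisc (W : LTree k) (top : Tm k) (ε : Bool) : ∀ {b m i : ℕ}, i < m →
    (unbDisc W top b m).bdry ε i = unbDisc W (utm (b + i) (W.bdry ε (b + i))) b i
  | b, m + 1, 0, _ => by
      rw [bdry_zero]
      cases ε <;> rfl
  | b, m + 1, i + 1, h => by
      rw [unbDisc, unbDisc, LTree.bdry, bdry_unbDisc W top ε (Nat.lt_of_succ_lt_succ h),
        Nat.add_assoc, Nat.add_comm 1 i]
      rfl

/-- An unbiased type determines the unbiased terms over the boundaries of lower dimension. -/
theorem utm_bdry_eq_of_uty_eq {l : ℕ} {W W' : LTree k} :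
    ∀ {n : ℕ}, uty n W = uty n W' → l < n → ∀ ε, utm l (W.bdry ε l) = utm l (W'.bdry ε l)
  | n + 1, h, hl, ε => by
      rw [uty_succ, uty_succ] at h
      injection h with _ h1 h2 h3
      rcases Nat.lt_succ_iff_lt_or_eq.mp hl with hl | rfl
      · exact utm_bdry_eq_of_uty_eq h2 hl ε
      · cases ε
        · exact h1
        · exact h3

theorem unbDisc_congr {W W' : LTree k} (top : Tm k) : ∀ {b m : ℕ},
    uty (b + m) W = uty (b + m) W' → unbDisc W top b m = unbDisc W' top b m
  | _, 0, _ => rfl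
  | b, m + 1, h => by
      have h1 := utm_bdry_eq_of_uty_eq h (l := b) (by omega)
      have h2 : uty (b + 1 + m) W = uty (b + 1 + m) W' := by
        rwa [Nat.add_assoc, Nat.add_comm 1 m]
      rw [unbDisc, unbDisc, unbDisc_congr top h2, h1, h1]

theorem uty_unbDisc (W : LTree k) (top : Tm k) {m : ℕ} : ∀ {n : ℕ}, n ≤ m →
    uty n (unbDisc W top 0 m) = uty n W
  | 0, _ => rfl
  | n + 1, h => by
      rw [uty_succ, uty_succ, uty_unbDisc W top (Nat.le_of_succ_le h),
        bdry_unbDisc _ _ _ h, bdry_unbDisc _ _ _ h, utm_of_disc (shape_unbDisc _ _ _ _),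
        utm_of_disc (shape_unbDisc _ _ _ _), leaf_unbDisc, leaf_unbDisc, Nat.zero_add]

/-- A tree and the disc labelled by its unbiased type and term have the same unbiased type in the
next dimension. -/
theorem uty_succ_unbDisc (W : LTree k) {m : ℕ} (hW : W.shape.dim ≤ m) :
    uty (m + 1) (unbDisc W (utm m W) 0 m) = uty (m + 1) W := by
  have hd : (unbDisc W (utm m W) 0 m).shape.dim ≤ m := by
    rw [shape_unbDisc, Tree.dim_disc]
  rw [uty_succ, uty_succ, bdry_eq_self _ _ hd, bdry_eq_self _ _ hd, bdry_eq_self _ _ hW,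
    bdry_eq_self _ _ hW, utm_of_disc (shape_unbDisc _ _ _ _), leaf_unbDisc,
    uty_unbDisc _ _ le_rfl]

/-- A labelled disc is given by its unbiased type and its top label. -/
theorem unbDisc_onTrunk_of_disc : ∀ {m : ℕ} {T : LTree k} (c : List (Tm k × Tm k)),
    T.shape = Tree.disc m → unbDisc (onTrunk c T) T.leaf c.length m = T
  | 0, pt t, c, _ => rfl
  | n + 1, pt t, _, h => by simp [shape, Tree.disc] at h
  | 0, cons _ _ _, _, h => by simp [shape, Tree.disc] at h
  | n + 1, cons t L (cons _ _ _), _, h => by simp [shape, Tree.disc] at h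
  | n + 1, cons t L (pt u), c, h => by
      simp only [shape, Tree.disc, Tree.cons.injEq, and_true] at h
      have := unbDisc_onTrunk_of_disc ((t, u) :: c) h
      rw [unbDisc, utm_bdry_onTrunk, utm_bdry_onTrunk]
      exact congrArg (fun X => cons t X (pt u)) this

theorem onTrunk_unbDisc (top : Tm k) : ∀ (c : List (Tm k × Tm k)) (T : LTree k) (m : ℕ),
    onTrunk c (unbDisc (onTrunk c T) top c.length m) =
      unbDisc (onTrunk c T) top 0 (c.length + m)
  | [], T, m => by simp [onTrunk]
  | p :: c, T, m => by
      have := onTrunk_unbDisc top c (cons p.1 T (pt p.2)) (m + 1)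
      rw [unbDisc, utm_bdry_onTrunk, utm_bdry_onTrunk] at this
      rw [List.length_cons, Nat.add_assoc, Nat.add_comm 1 m]
      exact this

theorem uty_length_succ_onTrunk (c : List (Tm k × Tm k)) (T : LTree k) :
    uty (c.length + 1) (onTrunk c T) = .arr T.first (trunkTy c) T.last := by
  rw [uty_succ, utm_bdry_onTrunk, utm_bdry_onTrunk, uty_onTrunk]
  rfl

/-- Truncation of the disc that ends in the unbiased coherence over `W`: up to disc removal, it is
the disc that ends in the unbiased coherence over the boundary of `W`. -/
theorem eqv_bdry_unbDisc {Γ : Ctx k} {W : LTree k} (hW : W.Typed sua Γ .star) (ε : Bool) :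
    ∀ {b m : ℕ} (n : ℕ), 1 ≤ b → W.shape.dim ≤ b + m →
      Eqv sua Γ (unbDisc (W.bdry ε (b + n)) (ucoh (b + min m n) (W.bdry ε (b + n))) b (min m n))
        ((unbDisc W (ucoh (b + m) W) b m).bdry ε n)
  | b, 0, n, hb, hd => by
      rw [Nat.zero_min, bdry_eq_self _ _ (by omega)]
      exact Eqv.refl _
  | b, m + 1, 0, hb, hd => by
      rw [Nat.min_zero, bdry_unbDisc _ _ _ (Nat.succ_pos m), Nat.add_zero]
      refine .pt (eqTm_ucoh_utm (hW.bdry ε b) hb ?_)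
      rw [shape_bdry]
      exact Tree.dim_bdry_le _ _
  | b, m + 1, n + 1, hb, hd => by
      have ih := eqv_bdry_unbDisc hW ε (b := b + 1) (m := m) n (by omega) (by omega)
      have e1 : b + 1 + n = b + (n + 1) := by omega
      have e2 : b + 1 + min m n = b + min (m + 1) (n + 1) := by omega
      have e3 : b + 1 + m = b + (m + 1) := by omega
      have e4 : min (m + 1) (n + 1) = min m n + 1 := by omega
      rw [e1, e2, e3] at ih
      rw [e4] at ih ⊢
      rw [unbDisc, unbDisc, LTree.bdry, bdry_bdry _ _ _ (by omega), bdry_bdry _ _ _ (by omega)]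
      exact .cons (EqTm.refl _) ih (.pt (EqTm.refl _))

end LTree

namespace LTree

variable {k : ℕ}

/-! ### Insertion of labelled trees -/

/-- `IsIns top c l S T V`: the labelled tree `V` arises from `S` by insertion of `T` along a branch
of `S` whose labels are those of the unbiased type of dimension `l` over `T`, and `top` at the end
of the branch. The relation is stated for the part of the situation that lies above a trunk with
labels `c`, so the tree inserted is `onTrunk c T` as a whole.

The branch splits off at the root of `S` (`here`), or passes through the first subtree of `S`, in
which case `T` has a trunk and shares its end points with `S` (`inside`), or passes to the right of
the first subtree (`next`). -/
inductive IsIns (top : Tm k) : List (Tm k × Tm k) → ℕ → LTree k → LTree k → LTree k → Prop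
  | here (c : List (Tm k × Tm k)) (m : ℕ) (T M : LTree k) : M.first = T.last →
      IsIns top c (c.length + 1 + m)
        (cons T.first (unbDisc (onTrunk c T) top (c.length + 1) m) M) T (T.append M)
  | inside {c : List (Tm k × Tm k)} {l : ℕ} {t : Tm k} {S T V M : LTree k} :
      IsIns top ((t, M.first) :: c) l S T V →
      IsIns top c l (cons t S M) (cons t T (pt M.first)) (cons t V M)
  | next {c : List (Tm k × Tm k)} {l : ℕ} (s : Tm k) (L : LTree k) {M T V : LTree k} :
      IsIns top c l M T V → IsIns top c l (cons s L M) T (cons s L V)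

variable {top : Tm k} {c : List (Tm k × Tm k)} {l : ℕ} {S T V : LTree k}

theorem IsIns.first_eq (h : IsIns top c l S T V) : V.first = S.first := by
  cases h with
  | here c m T M h => exact first_append T M
  | inside h => rfl
  | next s L h => rfl

theorem IsIns.last_eq (h : IsIns top c l S T V) : V.last = S.last := by
  induction h with
  | here c m T M h => exact last_append M T h
  | inside h => rfl
  | next s L h ih => exact ih

theorem IsIns.length_lt (h : IsIns top c l S T V) : c.length < l := by
  induction h with
  | here c m T M h => omega
  | inside h ih => simp only [List.length_cons] at ih; omega
  | next s L h ih => exact ih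

theorem IsIns.le_dim (h : IsIns top c l S T V) : l ≤ c.length + S.shape.dim := by
  induction h with
  | here c m T M h =>
    simp only [shape, Tree.dim, shape_unbDisc, Tree.dim_disc]
    omega
  | inside h ih =>
    simp only [shape, Tree.dim, List.length_cons] at *
    omega
  | next s L h ih =>
    simp only [shape, Tree.dim]
    omega

theorem dim_append (M : LTree k) : ∀ L : LTree k,
    (L.append M).shape.dim = max L.shape.dim M.shape.dim
  | pt t => by cases M <;> simp [append, setFirst, shape, Tree.dim]
  | cons t L L' => by
      simp only [append, shape, Tree.dim, dim_append M L']
      omega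

theorem IsIns.dim_le (h : IsIns top c l S T V) :
    V.shape.dim ≤ max S.shape.dim T.shape.dim := by
  induction h with
  | here c m T M h =>
    simp only [dim_append, shape, Tree.dim]
    omega
  | inside h ih =>
    simp only [shape, Tree.dim] at *
    omega
  | next s L h ih =>
    simp only [shape, Tree.dim]
    omega

theorem IsIns.typed_inserted {Γ : Ctx k} (h : IsIns top c l S T V) {A : Ty k}
    (hV : V.Typed R Γ A) : T.Typed R Γ A := by
  induction h generalizing A with
  | here c m T M h => exact ((typed_append_iff h).mp hV).1
  | inside h ih => exact ⟨hV.1, ih hV.2.1, hV.2.2.first⟩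
  | next s L h ih => exact ih hV.2.2

theorem IsIns.typed_result {Γ : Ctx k} (h : IsIns top c l S T V) {A : Ty k}
    (hS : S.Typed R Γ A) (hT : T.Typed R Γ A) : V.Typed R Γ A := by
  induction h generalizing A with
  | here c m T M h => exact (typed_append_iff h).mpr ⟨hT, hS.2.2⟩
  | inside h ih => exact ⟨hS.1, ih hS.2.1 hT.2.1, hS.2.2⟩
  | next s L h ih => exact ⟨hS.1, h.first_eq ▸ hS.2.1, ih hS.2.2 hT⟩

/-- If the result is typed and the top label has the unbiased type over the inserted tree, then the
tree inserted into is typed. -/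
theorem IsIns.typed_source {Γ : Ctx k} (h : IsIns top c l S T V)
    (hW : (onTrunk c T).Typed R Γ .star) (hV : V.Typed R Γ (trunkTy c))
    (htop : WfTm R Γ top (uty l (onTrunk c T))) : S.Typed R Γ (trunkTy c) := by
  induction h with
  | here c m T M h =>
    obtain ⟨hT, hM⟩ := (typed_append_iff h).mp hV
    refine ⟨hT.first, ?_, hM⟩
    rw [h, ← uty_length_succ_onTrunk]
    exact typed_unbDisc hW _ _ htop
  | inside h ih => exact ⟨hV.1, ih hW hV.2.1 htop, hV.2.2⟩
  | next s L h ih => exact ⟨hV.1, h.first_eq ▸ hV.2.1, ih hW hV.2.2 htop⟩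

/-- The label at the end of the branch may be changed. -/
theorem IsIns.change_top {Γ : Ctx k} (h : IsIns top c l S T V) (top' : Tm k) :
    ∃ S', IsIns top' c l S' T V ∧ S'.shape = S.shape ∧
      (EqTm R Γ top top' → Eqv R Γ S S') := by
  induction h with
  | here c m T M h =>
    exact ⟨_, .here c m T M h, by simp [shape], fun ht =>
      .cons (EqTm.refl _) (eqv_unbDisc _ ht _ _) (Eqv.refl _)⟩
  | @inside c l t S T V M h ih =>
    obtain ⟨S', h1, h2, h3⟩ := ih
    exact ⟨cons t S' M, .inside h1, by rw [shape, shape, h2], fun ht =>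
      .cons (EqTm.refl _) (h3 ht) (Eqv.refl _)⟩
  | @next c l s L M T V h ih =>
    obtain ⟨S', h1, h2, h3⟩ := ih
    exact ⟨cons s L S', .next s L h1, by rw [shape, shape, h2], fun ht =>
      .cons (EqTm.refl _) (Eqv.refl _) (h3 ht)⟩

/-- Insertion is compatible with truncation: either the truncation does not reach the branch
point, or it is an insertion along the truncated branch. -/
theorem IsIns.bdry {Γ : Ctx k} (ε : Bool) (ht : top = ucoh l (onTrunk c T))
    (h : IsIns top c l S T V) (hW : (onTrunk c T).Typed sua Γ .star)
    (hd : (onTrunk c T).shape.dim ≤ l) (n : ℕ) :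
    S.bdry ε n = V.bdry ε n ∨
      ∃ S', IsIns (ucoh (min l (c.length + n)) (onTrunk c (T.bdry ε n))) c (min l (c.length + n))
        S' (T.bdry ε n) (V.bdry ε n) ∧ Eqv sua Γ S' (S.bdry ε n) := by
  induction h generalizing n with
  | here c m T M h =>
    subst ht
    cases n with
    | zero =>
      rw [bdry_zero, bdry_zero, last_append M T h, first_append]
      exact .inl rfl
    | succ n =>
      right
      have e : min (c.length + 1 + m) (c.length + (n + 1)) = c.length + 1 + min m n := by omega
      have hb := bdry_onTrunk ε c T (n + 1)
      have hq := eqv_bdry_unbDisc hW ε (b := c.length + 1) (m := m) n (by omega) hd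
      rw [Nat.add_assoc, Nat.add_comm 1 n, hb] at hq
      have h' : (M.bdry ε (n + 1)).first = (T.bdry ε (n + 1)).last := by
        rw [first_bdry_succ, last_bdry_succ, h]
      have := IsIns.here (top := ucoh (c.length + 1 + min m n) (onTrunk c (T.bdry ε (n + 1))))
        c (min m n) (T.bdry ε (n + 1)) (M.bdry ε (n + 1)) h'
      rw [e, bdry_append_succ]
      refine ⟨_, this, ?_⟩
      rw [first_bdry_succ, LTree.bdry]
      exact .cons (EqTm.refl _) hq (Eqv.refl _)
  | @inside c l t S T V M h ih =>
    cases n with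
    | zero =>
      rw [bdry_zero, bdry_zero]
      exact .inl rfl
    | succ n =>
      rcases ih ht hW hd n with ih | ⟨S', h1, h2⟩
      · left
        rw [LTree.bdry, LTree.bdry, ih]
      · right
        refine ⟨cons t S' (M.bdry ε (n + 1)), ?_, .cons (EqTm.refl _) h2 (Eqv.refl _)⟩
        rw [List.length_cons, Nat.add_assoc, Nat.add_comm 1 n, ← first_bdry_succ ε M n] at h1
        have := IsIns.inside h1
        rw [onTrunk, first_bdry_succ] at this
        exact this
  | @next c l s L M T V h ih =>
    cases n with
    | zero =>
      rw [bdry_zero, bdry_zero, (IsIns.next s L h).last_eq, (IsIns.next s L h).first_eq]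
      exact .inl rfl
    | succ n =>
      rcases ih ht hW hd (n + 1) with ih | ⟨S', h1, h2⟩
      · left
        rw [LTree.bdry, LTree.bdry, ih]
      · right
        exact ⟨cons s (L.bdry ε n) S', .next _ _ h1, .cons (EqTm.refl _) (Eqv.refl _) h2⟩

/-- Insertion into a linear tree replaces the whole tree. -/
theorem IsIns.of_disc (h : IsIns top c l S T V) {m : ℕ} (hS : S.shape = Tree.disc m) :
    V = T ∧ l = c.length + m ∧ S = unbDisc (onTrunk c T) top c.length m := by
  induction h generalizing m with
  | here c n T M h =>
    cases m with
    | zero => simp [shape, Tree.disc] at hS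
    | succ m =>
      simp only [shape, Tree.disc, Tree.cons.injEq, shape_unbDisc] at hS
      have hnm : n = m := by
        rw [← Tree.dim_disc n, ← Tree.dim_disc m, hS.1]
      subst hnm
      cases M with
      | cons _ _ _ => simp [shape] at hS
      | pt u =>
        have happ : ∀ T : LTree k, T.append (pt T.last) = T := by
          intro T
          induction T with
          | pt t => rfl
          | cons t L L' _ ih => rw [append, LTree.last, ih]
        have hu : u = T.last := h
        subst hu
        refine ⟨happ T, by omega, ?_⟩
        rw [unbDisc, utm_bdry_onTrunk, utm_bdry_onTrunk]
        rfl
  | @inside c l t S T V M h ih =>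
    cases m with
    | zero => simp [shape, Tree.disc] at hS
    | succ m =>
      simp only [shape, Tree.disc, Tree.cons.injEq] at hS
      cases M with
      | cons _ _ _ => simp [shape] at hS
      | pt u =>
        obtain ⟨rfl, rfl, h3⟩ := ih hS.1
        refine ⟨rfl, by simp only [List.length_cons]; omega, ?_⟩
        rw [unbDisc, utm_bdry_onTrunk, utm_bdry_onTrunk]
        conv_lhs => rw [h3]
        rfl
  | @next c l s L M T V h ih =>
    cases m with
    | zero => simp [shape, Tree.disc] at hS
    | succ m =>
      simp only [shape, Tree.disc, Tree.cons.injEq] at hS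
      cases h <;> simp [shape] at hS

/-- Pruning: if the branch is longer than the dimension of the inserted tree, the insertion can be
split into the insertion of a disc of dimension one less than the length of the branch, which
shortens the branch, and the insertion along the shortened branch. -/
theorem IsIns.prune {Γ : Ctx k} (h : IsIns top c l S T V) {l' : ℕ} (hl : l = l' + 1)
    (hd : (onTrunk c T).shape.dim ≤ l') (hT : (onTrunk c T).shape ≠ Tree.disc l')
    (top' : Tm k) :
    ∃ S' V', IsIns top' c l S'
        (unbDisc (onTrunk c T) (utm l' (onTrunk c T)) c.length (l' - c.length)) V' ∧
      IsIns (utm l' (onTrunk c T)) c l' V' T V ∧ S'.shape = S.shape ∧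
      (EqTm R Γ top top' → Eqv R Γ S S') := by
  induction h with
  | here c m T M h =>
    have hlen : c.length ≤ l' := by omega
    cases m with
    | zero =>
      exfalso
      obtain rfl : l' = c.length := by omega
      rw [dim_onTrunk] at hd
      have hT0 : T.shape = Tree.disc 0 := by
        cases T with
        | pt t => rfl
        | cons t L M => simp [shape, Tree.dim] at hd
      exact hT (by simpa using shape_onTrunk_disc c hT0)
    | succ m =>
      obtain rfl : l' = c.length + 1 + m := by omega
      have e : c.length + 1 + m - c.length = m + 1 := by omega
      set W := onTrunk c T with hWdef
      set p := utm (c.length + 1 + m) W with hp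
      have hT' : unbDisc W p c.length (m + 1) =
          cons T.first (unbDisc W p (c.length + 1) m) (pt T.last) := by
        rw [unbDisc, hWdef, utm_bdry_onTrunk, utm_bdry_onTrunk]
        rfl
      have hW' : onTrunk c (unbDisc W p c.length (m + 1)) =
          unbDisc W p 0 (c.length + 1 + m) := by
        rw [hWdef, onTrunk_unbDisc, Nat.add_assoc, Nat.add_comm 1 m]
      have hcongr : unbDisc (onTrunk c (unbDisc W p c.length (m + 1))) top' (c.length + 1) (m + 1) =
          unbDisc W top' (c.length + 1) (m + 1) := by
        refine unbDisc_congr _ ?_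
        rw [hW', ← Nat.add_assoc]
        exact uty_succ_unbDisc W hd
      refine ⟨cons T.first (unbDisc W top' (c.length + 1) (m + 1)) M,
        cons T.first (unbDisc W p (c.length + 1) m) M, ?_, ?_, ?_, ?_⟩
      · rw [e]
        have := IsIns.here (top := top') c (m + 1) (unbDisc W p c.length (m + 1)) M
          (by rw [hT', h]; rfl)
        rw [hcongr] at this
        rw [hT'] at this ⊢
        have hM : (pt T.last : LTree k).append M = M := by
          rw [append, ← h, setFirst_first]
        rw [append, hM] at this
        exact this
      · exact .here c m T M h
      · simp [shape]
      · exact fun ht => .cons (EqTm.refl _) (eqv_unbDisc _ ht _ _) (Eqv.refl _)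
  | @inside c l t S T V M h ih =>
    obtain ⟨S', V', h1, h2, h3, h4⟩ := ih hl hd hT
    have hlt := h.length_lt
    rw [List.length_cons] at hlt
    refine ⟨cons t S' M, cons t V' M, ?_, .inside h2, by rw [shape, shape, h3], fun ht =>
      .cons (EqTm.refl _) (h4 ht) (Eqv.refl _)⟩
    obtain ⟨m, rfl⟩ : ∃ m, l' = c.length + 1 + m := ⟨l' - (c.length + 1), by omega⟩
    have e1 : c.length + 1 + m - c.length = m + 1 := by omega
    have e2 : c.length + 1 + m - (c.length + 1) = m := by omega
    rw [List.length_cons, e2] at h1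
    rw [e1, unbDisc, utm_bdry_onTrunk, utm_bdry_onTrunk]
    exact .inside h1
  | @next c l s L M T V h ih =>
    obtain ⟨S', V', h1, h2, h3, h4⟩ := ih hl hd hT
    exact ⟨cons s L S', cons s L V', .next _ _ h1, .next _ _ h2, by rw [shape, shape, h3],
      fun ht => .cons (EqTm.refl _) (Eqv.refl _) (h4 ht)⟩

end LTree

/-- The labelled tree underlying a labelling. -/
def Label.toLTree {k : ℕ} : {T : Tree} → Label k T → LTree k
  | _, .pt t => .pt t
  | _, .cons t L M => .cons t L.toLTree M.toLTree

namespace LTree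

variable {k : ℕ}

/-! ### Inserted substitutions -/

theorem first_toLTree {T : Tree} (L : Label k T) : L.toLTree.first = L.first := by
  cases L <;> rfl

theorem of_label : ∀ {T : Tree} (L : Label k T), of T L.toSub = L.toLTree
  | _, .pt t => rfl
  | .cons T Ts, .cons t L M => by
      have h0 : M.toSub 0 = M.first := by
        rw [← first_of Ts M.toSub, of_label M, first_toLTree]
      have e0 : (Label.cons t L M).toSub (wl 0) = t := wedgeElim_wl _ _ _
      have el : ∀ i, (Label.cons t L M).toSub (wl i.succ.succ) = L.toSub i :=
        fun i => wedgeElim_wl _ _ _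
      have er : ∀ i, (Label.cons t L M).toSub (wr 1 i) = M.toSub i :=
        fun i => wedgeElim_wr _ _ _ h0.symm _
      change LTree.cons ((Label.cons t L M).toSub (wl 0))
        (of _ fun i => (Label.cons t L M).toSub (wl i.succ.succ))
        (of _ fun i => (Label.cons t L M).toSub (wr 1 i)) = _
      simp only [e0, el, er]
      rw [of_label L, of_label M]
      rfl

theorem toLTree_ofSub : ∀ (T : Tree) (σ : Sub (T.len + 1) k),
    (Label.ofSub T σ).toLTree = of T σ
  | .nil, _ => rfl
  | .cons T Ts, σ => by
      rw [Label.ofSub, Label.toLTree, toLTree_ofSub T, toLTree_ofSub Ts]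
      rfl

theorem toLTree_setFirst (s : Tm k) {T : Tree} (L : Label k T) :
    (L.setFirst s).toLTree = L.toLTree.setFirst s := by
  cases L <;> rfl

theorem toLTree_append : ∀ {T U : Tree} (L : Label k T) (M : Label k U),
    (L.append M).toLTree = L.toLTree.append M.toLTree
  | _, _, .pt t, M => toLTree_setFirst t M
  | _, _, .cons t L L', M => by
      exact congrArg (LTree.cons t L.toLTree) (toLTree_append L' M)

theorem of_insSub {S : Tree} (P : Branch S) (T : Tree) (h : P.bh ≤ T.th)
    (σ : Sub (S.len + 1) k) (τ : Sub (T.len + 1) k) :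
    of (P.ins T h) (insSub P T h σ τ) =
      (Label.ins P T h (Label.ofSub S σ) (Label.ofSub T τ)).toLTree :=
  of_label _

theorem exists_branch_here {D : Tree} (Ts : Tree) {m : ℕ} (hD : D = Tree.disc m) :
    ∃ P : Branch (.cons D Ts), P.bh = 0 ∧ P.lh = m + 1 ∧
      P.leaf = wl (Fin.last D.len).succ.succ ∧
      ∀ (T : Tree) (h : P.bh ≤ T.th) (σ : Sub ((Tree.cons D Ts).len + 1) k)
        (τ : Sub (T.len + 1) k), of (P.ins T h) (insSub P T h σ τ) =
          (of T τ).append (of Ts fun i => σ (wr 1 i)) := by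
  subst hD
  refine ⟨.here m Ts, rfl, rfl, rfl, fun T h σ τ => ?_⟩
  rw [of_insSub]
  refine (toLTree_append (Label.ofSub T τ) (Label.ofSub Ts fun i => σ (wr 1 i))).trans ?_
  rw [toLTree_ofSub, toLTree_ofSub]

variable {top : Tm k} {c : List (Tm k × Tm k)} {l : ℕ} {S T V : LTree k}

/-- The relation `IsIns` comes from a branch of `S` with label `top`, and `V` is the inserted
substitution. -/
theorem IsIns.exists_branch (h : IsIns top c l S T V) :
    ∃ (P : Branch S.shape) (hb : P.bh ≤ T.shape.th), P.lh + c.length = l ∧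
      S.toSub P.leaf = top ∧
      of (P.ins T.shape hb) (insSub P T.shape hb S.toSub T.toSub) = V := by
  induction h with
  | here c m T M h =>
    obtain ⟨P, h1, h2, h3, h4⟩ := exists_branch_here (k := k) M.shape
      (shape_unbDisc (onTrunk c T) top (c.length + 1) m)
    have hb : P.bh ≤ T.shape.th := h1.le.trans (Nat.zero_le _)
    refine ⟨P, hb, (congrArg (· + c.length) h2).trans (by omega), ?_, ?_⟩
    · refine (congrArg _ h3).trans ((toSub_cons_wl _ _ _ _).trans ?_)
      rw [toSub_last_of_disc (shape_unbDisc _ _ _ _), leaf_unbDisc]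
    · refine (h4 T.shape hb _ _).trans ?_
      rw [of_shape_toSub]
      simp only [toSub_cons_wr]
      rw [of_shape_toSub]
  | @inside c l t S T V M h ih =>
    obtain ⟨P, hb, h1, h2, h3⟩ := ih
    have hb' : (Branch.inside P M.shape).bh ≤ (cons t T (pt M.first)).shape.th :=
      Nat.succ_le_succ hb
    refine ⟨.inside P M.shape, hb', ?_, ?_, ?_⟩
    · change P.lh + 1 + c.length = l
      rw [← h1, List.length_cons]
      omega
    · exact (toSub_cons_wl _ _ _ _).trans h2
    · rw [of_insSub] at h3
      refine (of_insSub (.inside P M.shape) (.cons T.shape .nil) hb' _ _).trans ?_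
      change LTree.cons ((cons t T (pt M.first)).toSub (wl 0))
        (Label.ins P T.shape hb
          (Label.ofSub S.shape fun i => (cons t S M).toSub (wl i.succ.succ))
          (Label.ofSub T.shape fun i => (cons t T (pt M.first)).toSub (wl i.succ.succ))).toLTree
        ((Label.ofSub M.shape fun i => (cons t S M).toSub (wr 1 i)).setFirst
          ((cons t T (pt M.first)).toSub (wr 1 0))).toLTree = _
      rw [toLTree_setFirst, toLTree_ofSub]
      simp only [toSub_cons_wl, toSub_cons_wr, toSub_cons_zero]
      rw [h3, of_shape_toSub]
      exact congrArg _ (setFirst_first M)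
  | @next c l s L M T V h ih =>
    obtain ⟨P, hb, h1, h2, h3⟩ := ih
    refine ⟨.next L.shape P, hb, h1, (toSub_cons_wr _ _ _ _).trans h2, ?_⟩
    rw [of_insSub] at h3
    refine (of_insSub (.next L.shape P) T.shape hb _ _).trans ?_
    change LTree.cons ((cons s L M).toSub (wl 0))
      (Label.ofSub L.shape fun i => (cons s L M).toSub (wl i.succ.succ)).toLTree
      (Label.ins P T.shape hb (Label.ofSub M.shape fun i => (cons s L M).toSub (wr 1 i))
          (Label.ofSub T.shape T.toSub)).toLTree = _
    rw [toLTree_ofSub]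
    simp only [toSub_cons_wl, toSub_cons_wr, toSub_cons_zero]
    rw [h3, of_shape_toSub]

/-! ### Exterior substitutions -/

/-- Replace the end of the leftmost path of a labelled tree by an arrow from it to `u` with
label `t`. -/
def graft (u t : Tm k) : LTree k → LTree k
  | pt s => cons s (pt t) (pt u)
  | cons a L M => cons a (L.graft u t) M

theorem snoc_snoc_succ_succ {X : Type} {n : ℕ} (σ : Fin (n + 2) → X) (u t : X)
    (i : Fin (n + 2)) :
    Fin.snoc (α := fun _ => X) (Fin.snoc (α := fun _ => X) σ u) t i.succ.succ =
      Fin.snoc (α := fun _ => X)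
        (Fin.snoc (α := fun _ => X) (fun j : Fin n => σ j.succ.succ) u) t i := by
  induction i using Fin.lastCases with
  | last => rw [Fin.succ_last, Fin.succ_last, Fin.snoc_last, Fin.snoc_last]
  | cast i =>
    rw [Fin.succ_castSucc, Fin.succ_castSucc, Fin.snoc_castSucc, Fin.snoc_castSucc]
    induction i using Fin.lastCases with
    | last => rw [Fin.succ_last, Fin.succ_last, Fin.snoc_last, Fin.snoc_last]
    | cast i =>
      rw [Fin.succ_castSucc, Fin.succ_castSucc, Fin.snoc_castSucc, Fin.snoc_castSucc]

theorem snoc_snoc_sub {n l : ℕ} (ρ : Sub k l) (σ : Fin n → Tm k) (u t : Tm k)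
    (i : Fin (n + 2)) :
    (Fin.snoc (α := fun _ => Tm k) (Fin.snoc (α := fun _ => Tm k) σ u) t i).sub ρ =
      Fin.snoc (α := fun _ => Tm l)
        (Fin.snoc (α := fun _ => Tm l) (fun j : Fin n => (σ j).sub ρ) (u.sub ρ)) (t.sub ρ) i := by
  induction i using Fin.lastCases with
  | last => rw [Fin.snoc_last, Fin.snoc_last]
  | cast i =>
    rw [Fin.snoc_castSucc, Fin.snoc_castSucc]
    induction i using Fin.lastCases with
    | last => rw [Fin.snoc_last, Fin.snoc_last]
    | cast i => rw [Fin.snoc_castSucc, Fin.snoc_castSucc]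

/-- A substitution out of a disc of the next dimension has two more variables at the end, and the
labelled tree is extended at its leaf. -/
theorem of_disc_snoc (u t : Tm k) : ∀ (m : ℕ) (σ : Sub ((Tree.disc m).len + 1) k),
    of (Tree.disc (m + 1))
        (Fin.snoc (α := fun _ => Tm k) (Fin.snoc (α := fun _ => Tm k) σ u) t) =
      (of (Tree.disc m) σ).graft u t
  | 0, _ => rfl
  | m + 1, σ => by
      have ih := of_disc_snoc u t m (fun i => σ (wl i.succ.succ))
      change cons (σ (wl 0)) (of (Tree.disc (m + 1)) _) (pt (σ (wr 1 0))) =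
        cons (σ 0) ((of (Tree.disc m) fun i => σ (wl i.succ.succ)).graft u t) (pt (σ (wr 1 0)))
      rw [← ih]
      refine congrArg (fun X => cons (σ 0) X (pt (σ (wr 1 0)))) (congrArg (of _) ?_)
      funext i
      exact snoc_snoc_succ_succ σ u t i

theorem graft_unbDisc (W : LTree k) (t : Tm k) : ∀ b m : ℕ,
    (unbDisc W (utm (b + m) (W.bdry false (b + m))) b m).graft
        (utm (b + m) (W.bdry true (b + m))) t = unbDisc W t b (m + 1)
  | _, 0 => rfl
  | b, m + 1 => by
      have ih := graft_unbDisc W t (b + 1) m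
      rw [Nat.add_assoc, Nat.add_comm 1 m] at ih
      rw [unbDisc, graft, ih]
      rfl

/-- The substitution given by an unbiased type and a term, as a labelled tree. -/
theorem of_discSub (W : LTree k) : ∀ (m : ℕ) (t : Tm k),
    of (Tree.disc m) (discSub m (uty m W) t) = unbDisc W t 0 m
  | 0, _ => rfl
  | m + 1, t => by
      have := graft_unbDisc W t 0 m
      rw [Nat.zero_add] at this
      rw [uty_succ, discSub, of_disc_snoc, of_discSub W m, this]

theorem discSub_comp {l : ℕ} (ρ : Sub k l) : ∀ (m : ℕ) (A : Ty k) (t : Tm k),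
    (discSub m A t).comp ρ = discSub m (A.sub ρ) (t.sub ρ)
  | 0, _, _ => rfl
  | _ + 1, .star, _ => rfl
  | m + 1, .arr s A u, t => by
      rw [discSub, Ty.sub, discSub, ← discSub_comp ρ m A s]
      exact funext fun i => snoc_snoc_sub ρ (discSub m A s) u t i

end LTree

theorem Tree.appendInl_zero : ∀ T U : Tree, T.appendInl U 0 = 0
  | .nil, _ => rfl
  | .cons _ _, _ => wedgeElim_wl _ _ 0

theorem Tree.appendInr_zero : ∀ T U : Tree, T.appendInr U 0 = T.appendInl U T.lastPt
  | .nil, _ => rfl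
  | .cons T Ts, U => by
      refine (congrArg (wr 1) (Tree.appendInr_zero Ts U)).trans ?_
      rw [Tree.appendInl, Tree.lastPt]
      refine (wedgeElim_wr (n := T.len + 2) wl (fun i => wr 1 (Ts.appendInl U i)) 1 ?_ _).symm
      rw [Tree.appendInl_zero]
      rfl

namespace LTree

variable {k : ℕ}

theorem of_append : ∀ (T U : Tree) (σ : Sub ((T.append U).len + 1) k),
    of (T.append U) σ =
      (of T fun i => σ (T.appendInl U i)).append (of U fun i => σ (T.appendInr U i))
  | .nil, U, σ => by
      have : (of U σ).first = σ 0 := first_of U σ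
      change of U σ = (of U σ).setFirst (σ 0)
      rw [← this, setFirst_first]
  | .cons T Ts, U, σ => by
      have e0 : (Tree.cons T Ts).appendInl U (wl 0) = wl 0 := wedgeElim_wl _ _ _
      have el : ∀ i : Fin (T.len + 1),
          (Tree.cons T Ts).appendInl U (wl i.succ.succ) = wl i.succ.succ :=
        fun i => wedgeElim_wl _ _ _
      have er : ∀ i, (Tree.cons T Ts).appendInl U (wr 1 i) = wr 1 (Ts.appendInl U i) :=
        fun i => wedgeElim_wr _ _ _ (by rw [Tree.appendInl_zero]; rfl) _
      change cons (σ (wl 0)) (of T fun i => σ (wl i.succ.succ))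
          (of (Ts.append U) fun i => σ (wr 1 i)) =
        cons (σ ((Tree.cons T Ts).appendInl U (wl 0)))
          (of T fun i => σ ((Tree.cons T Ts).appendInl U (wl i.succ.succ)))
          ((of Ts fun i => σ ((Tree.cons T Ts).appendInl U (wr 1 i))).append
            (of U fun i => σ (wr 1 (Ts.appendInr U i))))
      simp only [e0, el, er]
      rw [of_append Ts U]

theorem onTrunk_map_append {k' : ℕ} (φ : Tm k → Tm k') (d : List (Tm k' × Tm k')) :
    ∀ (c : List (Tm k × Tm k)) (T : LTree k),
      onTrunk (c.map (Prod.map φ φ) ++ d) (T.map φ) = onTrunk d ((onTrunk c T).map φ)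
  | [], _ => rfl
  | p :: c, T => onTrunk_map_append φ d c (cons p.1 T (pt p.2))

theorem map_unbDisc {k' : ℕ} {φ : Tm k → Tm k'} {d : List (Tm k' × Tm k')}
    (hφ : ∀ n X, φ (utm n X) = utm (d.length + n) (onTrunk d (X.map φ))) (W : LTree k)
    (top : Tm k) : ∀ b m : ℕ,
      (unbDisc W top b m).map φ = unbDisc (onTrunk d (W.map φ)) (φ top) (d.length + b) m
  | _, 0 => rfl
  | b, m + 1 => by
      rw [unbDisc, unbDisc, map, map_unbDisc hφ W top (b + 1) m, map, hφ, hφ, bdry_onTrunk,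
        bdry_onTrunk, bdry_map, bdry_map]
      rfl

/-- Relabelling of an insertion by a map that is compatible with unbiased terms, up to a
suspension given by the trunk `d`. -/
theorem IsIns.map {k' : ℕ} {φ : Tm k → Tm k'} {d : List (Tm k' × Tm k')}
    (hφ : ∀ n X, φ (utm n X) = utm (d.length + n) (onTrunk d (X.map φ)))
    {top : Tm k} {c : List (Tm k × Tm k)} {l : ℕ} {S T V : LTree k}
    (h : IsIns top c l S T V) :
    IsIns (φ top) (c.map (Prod.map φ φ) ++ d) (d.length + l) (S.map φ) (T.map φ) (V.map φ) := by
  induction h with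
  | here c m T M h =>
    have := IsIns.here (top := φ top) (c.map (Prod.map φ φ) ++ d) m (T.map φ) (M.map φ)
      (by rw [first_map, last_map, h])
    have e : (c.map (Prod.map φ φ) ++ d).length = d.length + c.length := by
      rw [List.length_append, List.length_map, Nat.add_comm]
    rw [onTrunk_map_append, e, Nat.add_assoc d.length, Nat.add_assoc d.length,
      ← map_unbDisc hφ, first_map, ← append_map] at this
    exact this
  | @inside c l t S T V M h ih =>
    rw [List.map_cons, List.cons_append, Prod.map,
      show φ M.first = (M.map φ).first from (first_map φ M).symm] at ih
    have := IsIns.inside ih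
    rw [first_map] at this
    exact this
  | next s L h ih => exact .next _ _ ih

/-- The exterior substitution exhibits the labelled tree given by the identity as the result of an
insertion. -/
theorem exists_isIns_ext : ∀ {S : Tree} (P : Branch S) (T : Tree) (h : P.bh ≤ T.th),
    ∃ LT : LTree ((P.ins T h).len + 1), LT.shape = T ∧
      IsIns (ucoh P.lh LT) [] P.lh (of S (P.ext T h)) LT (of (P.ins T h) (Sub.ident _))
  | _, .here m Ts, T, h => by
      have hs : (of T (Sub.ren (T.appendInl Ts))).shape = T := shape_of _ _
      refine ⟨of T (Sub.ren (T.appendInl Ts)), hs, ?_⟩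
      set LT := of T (Sub.ren (T.appendInl Ts)) with hLT
      set f := (discSub (m + 1) (unbTy (m + 1) T) (unbCoh (m + 1) T)).comp
        (Sub.ren (T.appendInl Ts)) with hf
      have hf' : f = discSub (m + 1) (uty (m + 1) LT) (ucoh (m + 1) LT) := by
        rw [hf, discSub_comp, hLT, uty_of, unbCoh_sub]
      have hd := of_discSub LT (m + 1) (ucoh (m + 1) LT)
      rw [← hf', unbDisc] at hd
      have hd' : cons (f 0) (of (Tree.disc m) fun i => f i.succ.succ) (pt (f 1)) = _ := hd
      injection hd' with h0 hl h1
      injection h1 with h1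
      have h0' : utm 0 (LT.bdry false 0) = LT.first := by
        rw [bdry_zero]; exact utm_zero_pt _
      have h1' : utm 0 (LT.bdry true 0) = LT.last := by
        rw [bdry_zero]; exact utm_zero_pt _
      have hlast : LT.last = .var (T.appendInl Ts T.lastPt) := last_of _ _
      have hr : ∀ i, wedgeElim f (Sub.ren (T.appendInr Ts)) (wr 1 i) =
          Sub.ren (T.appendInr Ts) i := by
        refine wedgeElim_wr _ _ _ ?_
        rw [h1, h1', hlast, Sub.ren, Tree.appendInr_zero]
      have hMf : (of Ts (Sub.ren (T.appendInr Ts))).first = LT.last := by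
        rw [first_of, hlast, Sub.ren, Tree.appendInr_zero]
      have hS : of (Tree.cons (Tree.disc m) Ts) ((Branch.here m Ts).ext T h) =
          cons LT.first (unbDisc LT (ucoh (m + 1) LT) 1 m)
            (of Ts (Sub.ren (T.appendInr Ts))) := by
        change cons (wedgeElim f (Sub.ren (T.appendInr Ts)) (wl 0))
          (of _ fun i => wedgeElim f (Sub.ren (T.appendInr Ts)) (wl i.succ.succ))
          (of _ fun i => wedgeElim f (Sub.ren (T.appendInr Ts)) (wr 1 i)) = _
        have el : ∀ i : Fin ((Tree.disc m).len + 1),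
            wedgeElim f (Sub.ren (T.appendInr Ts)) (wl i.succ.succ) = f i.succ.succ :=
          fun i => wedgeElim_wl _ _ _
        exact congr (congr (congrArg cons ((wedgeElim_wl _ _ _).trans (h0.trans h0')))
          ((congrArg (of _) (funext el)).trans hl)) (congrArg (of _) (funext hr))
      have hV : of ((Branch.here m Ts).ins T h) (Sub.ident _) =
          LT.append (of Ts (Sub.ren (T.appendInr Ts))) := of_append T Ts _
      rw [hS, hV]
      have := IsIns.here (top := ucoh (m + 1) LT) [] m LT _ hMf
      simp only [List.length_nil, Nat.zero_add, onTrunk] at this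
      rw [Nat.add_comm 1 m] at this
      exact this
  | _, .inside (S := S) P Ts, .cons T .nil, h => by
      obtain ⟨LT, hs, ih⟩ := exists_isIns_ext P T (Nat.le_of_succ_le_succ h)
      let U := P.ins T (Nat.le_of_succ_le_succ h)
      let κ := P.ext T (Nat.le_of_succ_le_succ h)
      let x : Tm ((Tree.cons U Ts).len + 1) := .var (wl 0)
      let M : LTree ((Tree.cons U Ts).len + 1) := of Ts (Sub.ren (wr 1))
      let ρ : Sub (U.len + 1) ((Tree.cons U Ts).len + 1) := Sub.ren fun i => wl i.succ.succ
      have hM : M.first = .var (wl 1) := first_of _ _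
      let φ : Tm (U.len + 1) → Tm ((Tree.cons U Ts).len + 1) :=
        fun s => s.susp.sub (suspExt x M.first ρ)
      have hφ : ∀ n X, φ (utm n X) = utm (1 + n) (onTrunk [(x, M.first)] (X.map φ)) := by
        intro n X
        rw [Nat.add_comm 1 n]
        exact utm_susp x M.first ρ n X
      have hρ : suspExt x M.first ρ = Sub.ren wl := by
        funext i
        induction i using suspCases with
        | h0 => rfl
        | h1 => exact hM
        | hs i => rfl
      have key := IsIns.inside (IsIns.map (d := [(x, M.first)]) hφ ih)
      have htop : φ (ucoh P.lh LT) = ucoh (P.lh + 1) (cons x (LT.map φ) (pt M.first)) :=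
        ucoh_susp x M.first ρ _ _
      refine ⟨cons x (LT.map φ) (pt M.first),
        congrArg (Tree.cons · .nil) ((shape_map φ LT).trans hs), ?_⟩
      rw [htop, List.length_singleton, Nat.add_comm 1 P.lh] at key
      have hS : of (Tree.cons S Ts) ((Branch.inside P Ts).ext (.cons T .nil) h) =
          cons x ((of S κ).map φ) M := by
        have e0 : (Branch.inside P Ts).ext (.cons T .nil) h (wl 0) = x :=
          Sub.wedge_wl κ.susp _ _ 0
        have el : ∀ i, (Branch.inside P Ts).ext (.cons T .nil) h (wl i.succ.succ) = φ (κ i) := by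
          intro i
          refine (Sub.wedge_wl κ.susp _ _ i.succ.succ).trans ?_
          rw [Sub.susp_succ, ← hρ]
          rfl
        have er : ∀ i, (Branch.inside P Ts).ext (.cons T .nil) h (wr 1 i) = .var (wr 1 i) :=
          fun i => Sub.wedge_wr κ.susp 1 _ 1 rfl rfl i
        change cons ((Branch.inside P Ts).ext (.cons T .nil) h (wl 0))
          (of _ fun i => (Branch.inside P Ts).ext (.cons T .nil) h (wl i.succ.succ))
          (of _ fun i => (Branch.inside P Ts).ext (.cons T .nil) h (wr 1 i)) = _
        simp only [e0, el, er]
        rw [of_map]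
        rfl
      have hV : of ((Branch.inside P Ts).ins (.cons T .nil) h) (Sub.ident _) =
          cons x ((of U (Sub.ident _)).map φ) M := by
        rw [of_map]
        rfl
      rw [hS, hV]
      exact key
  | _, .inside _ _, .nil, h => absurd h (Nat.not_succ_le_zero _)
  | _, .inside _ _, .cons _ (.cons _ _), h => absurd h (Nat.not_succ_le_zero _)
  | _, .next S (Ts := Ts) P, T, h => by
      obtain ⟨LT, hs, ih⟩ := exists_isIns_ext P T h
      let U := P.ins T h
      let κ := P.ext T h
      have hκ : κ 0 = .var 0 := by
        have := ih.first_eq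
        rw [first_of, first_of] at this
        exact this.symm
      let ρ : Sub (U.len + 1) ((Tree.cons S U).len + 1) := Sub.ren (wr 1)
      have hφ : ∀ n (X : LTree (U.len + 1)), (utm n X).sub ρ =
          utm ((([] : List (Tm ((Tree.cons S U).len + 1) × Tm ((Tree.cons S U).len + 1)))).length + n)
            (onTrunk [] (X.map fun s => s.sub ρ)) := by
        intro n X
        rw [List.length_nil, Nat.zero_add]
        exact utm_sub ρ n X
      have key := IsIns.next (.var (wl 0)) (of S (Sub.ren fun i => wl i.succ.succ))
        (IsIns.map (φ := fun s => s.sub ρ) (d := []) hφ ih)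
      refine ⟨LT.map fun s => s.sub ρ, by simp [hs], ?_⟩
      rw [ucoh_sub, List.length_nil, Nat.zero_add] at key
      have hS : of (Tree.cons S Ts) ((Branch.next S P).ext T h) =
          cons (.var (wl 0)) (of S (Sub.ren fun i => wl i.succ.succ))
            ((of Ts κ).map fun s => s.sub ρ) := by
        have el : ∀ i, (Branch.next S P).ext T h (wl i) = .var (wl i) :=
          fun i => Sub.wedge_wl (Sub.ident (S.len + 2 + 1)) 1 κ i
        have er : ∀ i, (Branch.next S P).ext T h (wr 1 i) = (κ i).sub ρ :=
          fun i => Sub.wedge_wr (Sub.ident (S.len + 2 + 1)) 1 κ 1 rfl hκ i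
        change cons ((Branch.next S P).ext T h (wl 0))
          (of _ fun i => (Branch.next S P).ext T h (wl i.succ.succ))
          (of _ fun i => (Branch.next S P).ext T h (wr 1 i)) = _
        simp only [el, er]
        rw [of_map]
        rfl
      have hV : of ((Branch.next S P).ins T h) (Sub.ident _) =
          cons (.var (wl 0)) (of S (Sub.ren fun i => wl i.succ.succ))
            ((of U (Sub.ident _)).map fun s => s.sub ρ) := by
        rw [of_map]
        rfl
      rw [hS, hV]
      exact key

end LTree

/-! ### Dimensions of variables -/

theorem Ty.dim_sub {m n : ℕ} (σ : Sub m n) : ∀ A : Ty m, (A.sub σ).dim = A.dim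
  | .star => rfl
  | .arr s A t => by rw [Ty.sub, Ty.dim, Ty.dim, Ty.dim_sub σ A]

theorem Ty.dim_susp {n : ℕ} : ∀ A : Ty n, A.susp.dim = A.dim + 1
  | .star => by rw [Ty.susp]; rfl
  | .arr s A t => by rw [Ty.susp, Ty.dim, Ty.dim, Ty.dim_susp A]

theorem dim_unbTy : ∀ (n : ℕ) (T : Tree), (unbTy n T).dim = n
  | 0, _ => rfl
  | n + 1, T => by rw [unbTy_succ, Ty.dim, dim_unbTy n T]

theorem Tree.dim_lookup_le : ∀ (T : Tree) (x : Fin (T.len + 1)), (T.ctx.lookup x).dim ≤ T.dim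
  | .nil, x => by
      obtain rfl : x = 0 := Subsingleton.elim (α := Fin 1) x 0
      rw [Tree.lookup_zero]
      exact le_rfl
  | .cons T Ts, x => by
      rw [Tree.dim]
      induction x using Tree.consCases with
      | h0 => rw [Tree.lookup_cons_zero]; exact Nat.zero_le _
      | hl i =>
        rw [Tree.lookup_cons_wl]
        refine (Ty.dim_sub _ _).le.trans ?_
        rw [Ty.dim_susp]
        have := T.dim_lookup_le i
        omega
      | hr i =>
        rw [Tree.lookup_cons_wr]
        refine (Ty.dim_sub _ _).le.trans ?_
        have := Ts.dim_lookup_le i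
        omega

theorem Tree.exists_dim_lookup_eq : ∀ T : Tree, ∃ x, (T.ctx.lookup x).dim = T.dim
  | .nil => ⟨0, by rw [Tree.lookup_zero]; rfl⟩
  | .cons T Ts => by
      rcases le_total (T.dim + 1) Ts.dim with h | h
      · obtain ⟨x, hx⟩ := Ts.exists_dim_lookup_eq
        refine ⟨wr 1 x, ?_⟩
        rw [Tree.lookup_cons_wr, Tree.dim, max_eq_right h]
        exact (Ty.dim_sub _ _).trans hx
      · obtain ⟨x, hx⟩ := T.exists_dim_lookup_eq
        refine ⟨wl x.succ.succ, ?_⟩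
        rw [Tree.lookup_cons_wl, Tree.dim, max_eq_left h, ← hx, ← Ty.dim_susp]
        exact Ty.dim_sub _ _

theorem Ctx.Glob.dim_lookup_lt {n : ℕ} {Γ : Ctx n} {A : Ty n} (h : Γ.Glob A) :
    ∀ x ∈ A.fv, (Γ.lookup x).dim < A.dim := by
  induction h with
  | star => rintro x ⟨⟩
  | arr y z _ hy hz ih =>
    rintro x ((rfl | hx) | rfl)
    · rw [hy, Ty.dim]; omega
    · have := ih x hx
      rw [Ty.dim]; omega
    · rw [hz, Ty.dim]; omega

theorem Tree.dim_lookup_le_of_mem_supp {ε : Bool} {T : Tree} {n : ℕ} {x : Fin (T.len + 1)}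
    (hx : x ∈ (T.incl ε n).supp T.ctx) : (T.ctx.lookup x).dim ≤ n := by
  refine Ctx.downClosure_subset (Y := {x | (T.ctx.lookup x).dim ≤ n}) ?_ ?_ hx
  · intro y hy
    obtain ⟨i, hi⟩ := Set.mem_iUnion.mp hy
    obtain ⟨f, hf, hf'⟩ := T.incl_eq_ren ε n
    rw [hf] at hi
    rw [show y = f i from hi]
    change (T.ctx.lookup (f i)).dim ≤ n
    rw [hf', Ty.dim_sub]
    exact ((T.bdry n).dim_lookup_le i).trans (T.dim_bdry_le n)
  · intro y hy z hz
    exact ((T.glob_lookup y).dim_lookup_lt z hz).le.trans hy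

/-! ### Inversion of coherences -/

/-- A property of the context and of the type of a coherence. -/
def Tm.CohProp (p : ∀ k : ℕ, Ctx k → Ty k → Prop) {n : ℕ} : Tm n → Prop
  | .var _ => True
  | .coh Δ A _ => p _ Δ A

/-- The support of the source of a valid coherence contains a variable of codimension at
most one. -/
theorem WfTm.cohProp {n : ℕ} {Γ : Ctx n} {t : Tm n} {B : Ty n} : WfTm R Γ t B →
    t.CohProp fun _ Δ A => ∀ s A' u, A = .arr s A' u →
      ∃ x ∈ s.supp Δ, ∀ y, (Δ.lookup y).dim ≤ (Δ.lookup x).dim + 1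
  | .var _ _ => trivial
  | .comp (T := T) d hd _ _ hs _ => by
      rintro s A' u ⟨⟩
      obtain ⟨i, hi⟩ := (T.bdry d).exists_dim_lookup_eq
      obtain ⟨f, hf, hf'⟩ := T.incl_eq_ren false d
      refine ⟨f i, ?_, fun y => ?_⟩
      · rw [hs]
        refine Ctx.subset_downClosure _ _ (Set.mem_iUnion.mpr ⟨i, ?_⟩)
        rw [hf]
        rfl
      · rw [hf', Ty.dim_sub, hi, T.dim_bdry_eq (by omega), ← hd]
        exact T.dim_lookup_le y
  | .coh (T := T) _ _ hs _ => by
      rintro s A' u ⟨⟩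
      obtain ⟨x, hx⟩ := T.exists_dim_lookup_eq
      refine ⟨x, by rw [hs]; trivial, fun y => ?_⟩
      have := T.dim_lookup_le y
      omega
  | .conv h _ => h.cohProp

/-- An unbiased coherence can only be valid in dimensions at least that of the tree. -/
theorem dim_le_of_wfTm_unbCoh {n : ℕ} {Γ : Ctx n} {T : Tree} {l : ℕ} {σ : Sub (T.len + 1) n}
    {B : Ty n} (hl : 1 ≤ l) (h : WfTm R Γ ((unbCoh l T).sub σ) B) : T.dim ≤ l := by
  obtain ⟨l, rfl⟩ := Nat.exists_eq_add_of_le' hl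
  obtain ⟨x, hx, hy⟩ := h.cohProp _ _ _ (unbTy_succ l T)
  rw [supp_unbTm] at hx
  obtain ⟨y, hy'⟩ := T.exists_dim_lookup_eq
  have := hy y
  have := Tree.dim_lookup_le_of_mem_supp hx
  omega

theorem Tree.two_mul_dim_le_len : ∀ T : Tree, 2 * T.dim ≤ T.len
  | .nil => le_rfl
  | .cons T Ts => by
      have := T.two_mul_dim_le_len
      have := Ts.two_mul_dim_le_len
      rw [Tree.dim, Tree.len]
      omega

theorem Tree.len_disc : ∀ n : ℕ, (Tree.disc n).len = 2 * n
  | 0 => rfl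
  | n + 1 => by
      rw [Tree.disc, Tree.len, Tree.len_disc n, Tree.len]
      omega

/-- Discs have the least number of variables among the trees of a given dimension. -/
theorem Tree.eq_disc_of_len : ∀ {m : ℕ} {T : Tree}, m ≤ T.dim → T.len = 2 * m →
    T = Tree.disc m
  | m, .nil, _, h => by
      obtain rfl : m = 0 := by rw [Tree.len] at h; omega
      rfl
  | 0, .cons T Ts, _, h => by rw [Tree.len] at h; omega
  | m + 1, .cons T Ts, hd, h => by
      have h1 := T.two_mul_dim_le_len
      have h2 := Ts.two_mul_dim_le_len
      rw [Tree.dim] at hd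
      rw [Tree.len] at h
      have h3 : m ≤ T.dim := by
        rcases le_max_iff.mp hd with h' | h' <;> omega
      rw [Tree.disc, ← Tree.eq_disc_of_len h3 (by omega)]
      cases Ts with
      | nil => rfl
      | cons _ _ => rw [Tree.len] at h; omega

namespace LTree

variable {k : ℕ}

/-! ### Identities -/

/-- If the unbiased coherence over a tree is an identity, the tree is a disc: the source of its type
is a variable, so the boundary of dimension `m` is the disc, and the number of variables of the tree
leaves no room for more. -/
theorem shape_eq_disc_of_isIdentity {m : ℕ} {L : LTree k} (h : IsIdentity (ucoh (m + 1) L)) :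
    L.shape = Tree.disc m := by
  obtain ⟨m', σ, h⟩ := h
  have hp : (ucoh (m + 1) L).CohProp fun k _ A =>
      k = 2 * m' + 1 ∧ A.dim = m' + 1 ∧ ∃ x B t, A = .arr (.var x) B t := by
    rw [h]
    obtain ⟨f, hf, -⟩ := (Tree.disc m').incl_eq_ren false m'
    refine ⟨by rw [Tree.len_disc], dim_unbTy _ _, ?_⟩
    rw [unbTy_succ, unbTm, if_pos (Tree.bdry_eq_self _ (Tree.dim_disc m').le), Tm.sub, hf]
    exact ⟨_, _, _, rfl⟩
  obtain ⟨h1, h2, x, B, t, h3⟩ := hp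
  rw [dim_unbTy] at h2
  obtain rfl : m = m' := by omega
  rw [unbTy_succ] at h3
  have hb : L.shape.bdry m = Tree.disc m := by
    by_contra hb
    rw [unbTm, if_neg hb] at h3
    injection h3 with _ h3
    cases h3
  refine Tree.eq_disc_of_len ?_ (by omega)
  rw [← Tree.dim_disc m, ← hb]
  exact Tree.dim_bdry_le_dim _ _

theorem idTm_uty (m : ℕ) (L : LTree k) (t : Tm k) :
    idTm (uty m L) t = ucoh (m + 1) (unbDisc L t 0 m) := by
  have hd : (uty m L).dim = m := by rw [uty, Ty.dim_sub, dim_unbTy]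
  rw [← of_discSub, ← unbCoh_sub, idTm, hd]

/-- An unbiased coherence over a tree of smaller dimension is an identity, by removal of
endo-coherences. -/
theorem eqTm_ucoh_unbDisc {Γ : Ctx k} {L : LTree k} (hL : L.Typed sua Γ .star) {m : ℕ}
    (hd : L.shape.dim ≤ m) :
    EqTm sua Γ (ucoh (m + 1) L) (ucoh (m + 1) (unbDisc L (utm m L) 0 m)) := by
  by_cases hid : IsIdentity (ucoh (m + 1) L)
  · have hs := shape_eq_disc_of_isIdentity hid
    have := unbDisc_onTrunk_of_disc [] hs
    rw [onTrunk, List.length_nil] at this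
    rw [utm_of_disc hs, this]
    exact EqTm.refl _
  · have e : unbTy (m + 1) L.shape =
        .arr (unbTm m L.shape) (unbTy m L.shape) (unbTm m L.shape) := by
      have h1 := uty_succ m (of L.shape (Sub.ident _))
      have hd' : (of L.shape (Sub.ident _)).shape.dim ≤ m := by rwa [shape_of]
      rwa [bdry_eq_self _ _ hd', bdry_eq_self _ _ hd', uty_of, uty_of, utm_of, Ty.sub_ident,
        Ty.sub_ident, Tm.sub_ident] at h1
    have hw := hL.ucoh (n := m + 1) (by omega) (by omega)
    rw [← idTm_uty]
    rw [ucoh, e] at hid hw ⊢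
    exact .rule (.endoCoherenceRemoval Γ _ _ _ _ hid) hw

/-! ### Insertion into unbiased coherences -/

/-- Insertion along a branch labelled by `{𝒰_T, 𝒞_T}` preserves unbiased types of dimension `n`. -/
def InsTy (n : ℕ) : Prop :=
  ∀ ⦃k : ℕ⦄ ⦃Γ : Ctx k⦄ ⦃l : ℕ⦄ ⦃S T V : LTree k⦄, S.Typed sua Γ .star → T.Typed sua Γ .star →
    IsIns (ucoh l T) [] l S T V → T.shape.dim ≤ l → EqTy sua Γ (uty n S) (uty n V)

theorem typed_source_ucoh {Γ : Ctx k} {l : ℕ} {S T V : LTree k}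
    (h : IsIns (ucoh l T) [] l S T V) (hT : T.Typed R Γ .star) (hV : V.Typed R Γ .star)
    (hd : T.shape.dim ≤ l) : S.Typed R Γ .star :=
  h.typed_source hT hV (hT.ucoh h.length_lt hd)

/-- The exterior substitution preserves unbiased types. -/
theorem InsTy.ext {n : ℕ} (hA : InsTy n) {S : Tree} (P : Branch S) (T : Tree)
    (h : P.bh ≤ T.th) (hd : T.dim ≤ P.lh) :
    EqTy sua (P.ins T h).ctx ((unbTy n S).sub (P.ext T h)) (unbTy n (P.ins T h)) := by
  obtain ⟨LT, hs, hI⟩ := exists_isIns_ext P T h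
  rw [← hs] at hd
  have hV := typed_ident (R := sua) (P.ins T h)
  have hT := hI.typed_inserted hV
  have := hA (typed_source_ucoh hI hT hV hd) hT hI hd
  rwa [uty_of, uty_of, Ty.sub_ident] at this

/-- A single use of the insertion rule. -/
theorem InsTy.eqTm_ucoh {n : ℕ} (hA : InsTy (n + 1)) {Γ : Ctx k} {l : ℕ} {S T V : LTree k}
    (hS : S.Typed sua Γ .star) (hI : IsIns (ucoh l T) [] l S T V) (hd : T.shape.dim ≤ l)
    (hSd : S.shape.dim ≤ n + 1) (hSn : S.shape ≠ Tree.disc n)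
    (hl : l = T.shape.dim ∨ ∃ m, l = m + 1 ∧ T.shape = Tree.disc m) :
    EqTm sua Γ (ucoh (n + 1) S) (ucoh (n + 1) V) := by
  obtain ⟨P, hb, rfl, hleaf, rfl⟩ := hI.exists_branch
  rw [List.length_nil, Nat.add_zero] at *
  have hredex : InsertionRedex P T.shape S.toSub T.toSub :=
    ⟨hb, by rw [hleaf, unbCoh_sub, of_shape_toSub]⟩
  have hcond : P.lh = T.shape.dim ∨ IsIdentity (unbCoh P.lh T.shape) := by
    refine hl.imp_right ?_
    rintro ⟨m, hm, hT⟩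
    rw [hm, hT]
    exact ⟨m, Sub.ident _, (Tm.sub_ident _).symm⟩
  have hrule := sua.insertion Γ P T.shape (unbTy (n + 1) S.shape) S.toSub T.toSub hredex hcond
    fun hid => hSn (shape_eq_disc_of_isIdentity hid)
  refine (EqTm.rule hrule (hS.ucoh (by omega) hSd)).trans ?_
  rw [ucoh_of]
  exact .coh (hA.ext P T.shape hb hd) fun i => EqTm.refl _

/-- Insertion preserves unbiased terms of dimension `n`, provided that it preserves unbiased types.
The proof is by induction on the height of the leaf of the branch. -/
theorem InsTy.eqTm_utm {n : ℕ} (hA : InsTy n) {Γ : Ctx k} {T : LTree k}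
    (hT : T.Typed sua Γ .star) : ∀ {l : ℕ} {S V : LTree k}, S.Typed sua Γ .star →
      IsIns (ucoh l T) [] l S T V → T.shape.dim ≤ l → S.shape.dim ≤ n →
        EqTm sua Γ (utm n S) (utm n V) := by
  intro l
  induction l with
  | zero => exact fun _ hI => absurd hI.length_lt (Nat.not_lt_zero _)
  | succ l ih =>
    intro S V hS hI hd hSn
    have hln : l + 1 ≤ n := by
      have := hI.le_dim
      rw [List.length_nil] at this
      omega
    obtain ⟨n, rfl⟩ := Nat.exists_eq_add_of_le' (Nat.le_trans (Nat.succ_pos l) hln)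
    have hV := hI.typed_result hS hT
    have hVd : V.shape.dim ≤ n + 1 := by
      have := hI.dim_le
      omega
    by_cases hS1 : S.shape = Tree.disc (n + 1)
    · obtain ⟨rfl, hl, hS2⟩ := hI.of_disc hS1
      rw [List.length_nil, Nat.zero_add] at hl
      obtain rfl : l = n := by omega
      rw [utm_of_disc hS1, hS2, leaf_unbDisc]
      exact eqTm_ucoh_utm hT (by omega) hd
    rw [utm_of_not_disc hS1]
    by_cases hS0 : S.shape = Tree.disc n
    · -- The coherence over `S` is an identity, to which the insertion rule does not apply. The one
      -- over `V = T` is an endo-coherence, hence equal to an identity as well.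
      obtain ⟨rfl, hl, hS2⟩ := hI.of_disc hS0
      rw [List.length_nil, Nat.zero_add] at hl
      subst hl
      rw [onTrunk, List.length_nil] at hS2
      rw [hS2]
      refine ((eqv_unbDisc V (eqTm_ucoh_utm hT (by omega) hd) 0 _).ucoh _).trans ?_
      exact (eqTm_ucoh_unbDisc hT hd).symm.trans (eqTm_ucoh_utm hT (by omega) hVd)
    by_cases hl : l + 1 = T.shape.dim ∨ ∃ m, l + 1 = m + 1 ∧ T.shape = Tree.disc m
    · exact (hA.eqTm_ucoh hS hI hd hSn hS0 hl).trans (eqTm_ucoh_utm hV (by omega) hVd)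
    push Not at hl
    have hd' : T.shape.dim ≤ l := by omega
    have hTl : T.shape ≠ Tree.disc l := hl.2 l rfl
    -- The unbiased coherence over `T` equals an identity, which is inserted first: it is the
    -- unbiased coherence over the disc `T'` whose top label is the unbiased term over `T`.
    let T' : LTree k := unbDisc T (utm l T) 0 l
    have hT's : T'.shape = Tree.disc l := shape_unbDisc _ _ _ _
    have hT'd : T'.shape.dim = l := by rw [hT's, Tree.dim_disc]
    have hT' : T'.Typed sua Γ .star :=
      typed_unbDisc hT 0 l (by rw [Nat.zero_add]; exact hT.utm hd')
    obtain ⟨S', V', hI1, hI2, hs, hq⟩ := hI.prune (Γ := Γ) (R := sua) rfl hd' hTl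
      (ucoh (l + 1) T')
    change IsIns _ [] _ S' T' V' at hI1
    change IsIns (utm l T) [] l V' T V at hI2
    have hl1 : 1 ≤ l := hI2.length_lt
    have hV' : V'.Typed sua Γ .star := hI2.typed_source hT hV (hT.utm hd')
    have hS' : S'.Typed sua Γ .star := typed_source_ucoh hI1 hT' hV' (by omega)
    obtain ⟨V'', hI3, hs', hq'⟩ := hI2.change_top (Γ := Γ) (R := sua) (ucoh l T)
    have hV'' : V''.Typed sua Γ .star := typed_source_ucoh hI3 hT hV hd'
    have hV''d : V''.shape.dim ≤ n + 1 := by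
      have := hI1.dim_le
      rw [hs']
      rw [hs] at this
      omega
    have e1 := (hq (eqTm_ucoh_unbDisc hT hd')).ucoh (n + 1)
    have e2 := hA.eqTm_ucoh hS' hI1 (by omega) (by rwa [hs]) (by rwa [hs]) (.inr ⟨l, rfl, hT's⟩)
    have e3 := (hq' (eqTm_ucoh_utm hT hl1 hd').symm).ucoh (n + 1)
    have e4 := eqTm_ucoh_utm hV'' (n := n + 1) (by omega) hV''d
    exact e1.trans (e2.trans (e3.trans (e4.trans (ih hV'' hI3 hd' hV''d))))

/-- The types in dimension `n + 1` are built from the terms over the boundaries. The boundary of an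
insertion is unchanged, or is an insertion again up to disc removal. -/
theorem insTy : ∀ n : ℕ, InsTy n
  | 0 => fun _ _ _ _ _ _ _ _ _ _ => .star
  | n + 1 => by
      intro k Γ l S T V hS hT hI hd
      have hA := insTy n
      have hV := hI.typed_result hS hT
      have hb : ∀ ε, EqTm sua Γ (utm n (S.bdry ε n)) (utm n (V.bdry ε n)) := by
        intro ε
        rcases IsIns.bdry (c := []) (Γ := Γ) ε rfl hI hT hd n with h | ⟨S', h1, h2⟩
        · rw [h]
          exact EqTm.refl _
        · rw [List.length_nil, Nat.zero_add] at h1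
          have hTd : (T.bdry ε n).shape.dim ≤ min l n := by
            rw [shape_bdry]
            have := T.shape.dim_bdry_le n
            have := T.shape.dim_bdry_le_dim n
            omega
          have hSd : S'.shape.dim ≤ n := by
            rw [h2.shape_eq, shape_bdry]
            exact Tree.dim_bdry_le _ _
          have hS' := typed_source_ucoh h1 (hT.bdry ε n) (hV.bdry ε n) hTd
          exact (h2.symm.utm n).trans (hA.eqTm_utm (hT.bdry ε n) hS' h1 hTd hSd)
      rw [uty_succ, uty_succ]
      exact .arr (hb false) (hb true) (hA hS hT hI hd)

end LTree

theorem Branch.one_le_lh : ∀ {S : Tree} (P : Branch S), 1 ≤ P.lh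
  | _, .here _ _ => Nat.succ_pos _
  | _, .inside _ _ => Nat.succ_pos _
  | _, .next _ P => P.one_le_lh

end CattSua

theorem mainTheorem5 {k : ℕ} (Γ : CattSua.Ctx k) (S T : CattSua.Tree) (P : CattSua.Branch S)
    (σ : CattSua.Sub (S.len + 1) k) (τ : CattSua.Sub (T.len + 1) k)
    (h : CattSua.InsertionRedex P T σ τ)
    (hσ : CattSua.WfSub CattSua.sua Γ S.ctx σ) (hτ : CattSua.WfSub CattSua.sua Γ T.ctx τ)
    (n : ℕ) (hn : T.dim ≤ n) :
    CattSua.EqTm CattSua.sua Γ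
      (.coh (P.ins T h.bh_le_th).ctx
        ((CattSua.unbTy n S).sub (P.ext T h.bh_le_th))
        (CattSua.insSub P T h.bh_le_th σ τ))
      ((CattSua.unbCoh n (P.ins T h.bh_le_th)).sub
        (CattSua.insSub P T h.bh_le_th σ τ)) := by
  obtain ⟨A, hA⟩ := hσ.exists_wfTm P.leaf
  rw [h.leaf_eq] at hA
  exact .coh ((CattSua.LTree.insTy n).ext P T h.bh_le_th
    (CattSua.dim_le_of_wfTm_unbCoh P.one_le_lh hA)) fun i => CattSua.EqTm.refl _
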